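/- **Setting.** Let $\mathcal M(0,1)$ be the set of all Lebesgue measurable functions $f:(0,1)\to[-\infty,\infty]$ and $\mathcal M_+(0,1)$ the set of nonnegative ones; write $|E|$ for Lebesgue measure. For $f\in\mathcal M(0,1)$ the nonincreasing rearrangement is $f^*(t)=\inf\{\lambda\ge 0: |\{x\in(0,1):|f(x)|>\lambda\}|\le t\}$, $t\in(0,1)$ ($\inf\emptyset=\infty$). A functional $\|\cdot\|_{X}:\mathcal M(0,1)\to[0,\infty]$ is a *rearrangement-invariant norm* if for all $f,g,f_k\in\mathcal M_+(0,1)$, $u,v\in\mathcal M(0,1)$ and $a\ge 0$: $\|f\|_X=0\Leftrightarrow f=0$ a.e.; $\|af\|_X=a\|f\|_X$; $\|f+g\|_X\le\|f\|_X+\|g\|_X$; $f\le g$ a.e. implies $\|f\|_X\le\|g\|_X$; $f_k\uparrow f$ a.e. implies $\|f_k\|_X\uparrow\|f\|_X$; $\|1\|_X<\infty$; $\int_0^1 f\le C\|f\|_X$ with a constant $C>0$ independent of $f$; and $\|u\|_X=\|v\|_X$ whenever $|\{|u|>\lambda\}|=|\{|v|>\lambda\}|$ for all $\lambda\ge0$.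 The space is $X=X(0,1)=\{f\in\mathcal M(0,1):\|f\|_X<\infty\}$, and two such spaces are equal if they consist of the same functions. The associate norm is $\|f\|_{X'}=\sup_{\|g\|_X\le1}\int_0^1|fg|$. The *almost-compact embedding* $X\overset{*}{\hookrightarrow}Y$ means that $\lim_{k\to\infty}\sup_{\|f\|_X\le1}\|\chi_{E_k}f\|_Y=0$ for every sequence of measurable sets $E_k\subseteq(0,1)$ with $\chi_{E_k}\to0$ a.e. Let $J:(0,1]\to(0,\infty)$ be a measurable function with $\inf_{t\in(0,1]}J(t)/t>0$ and let $j\in\mathbb N$, $j\ge1$. For $f\in\mathcal M(0,1)$ and $t\in(0,1)$ put $$H_Jf(t)=\int_t^1\frac{|f(s)|}{J(s)}\,ds,\qquad R_Jf(t)=\frac1{J(t)}\int_0^t|f(s)|\,ds,$$ and let $H_J^j$, $R_J^j$ be the $j$-fold compositions of $H_J$, $R_J$ with themselves. For a rearrangement-invariant norm $\|\cdot\|_X$ let $\|f\|_{(X^r_{j,J})'}=\|R_J^jf^*\|_{X'}$, and let $\|\cdot\|_{X^r_{j,J}}$ be the associate norm of $\|\cdot\|_{(X^r_{j,J})'}$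 (the norm of the optimal range space of $X$ under $H^j_J$). The operator $H_J^j$ is *compact* from $X$ into $Y$, written $H^j_J:X\to\to Y$, if it maps $X$ into $Y$ and for every sequence $(f_k)$ bounded in $X$ the sequence $(H_J^jf_k)$ has a subsequence converging in the norm of $Y$ to an element of $Y$. **Theorem 4.2.** Let $J$ and $j$ be as above and let $\|\cdot\|_X$, $\|\cdot\|_Y$ be rearrangement-invariant norms on $\mathcal M(0,1)$. If $$Y(0,1)\neq L^\infty(0,1)\quad\text{or}\quad\int_0^1\frac{dr}{J(r)}=\infty,$$ then the following conditions are equivalent: (i) $H_J^j:X(0,1)\to\to Y(0,1)$; (ii) $\displaystyle\lim_{a\to0_+}\ \sup_{\|f\|_X\le1}\|\chi_{(0,a)}H_J^jf\|_Y=0$; (iii) $X^r_{j,J}(0,1)\overset{*}{\hookrightarrow}Y(0,1)$. -/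

import Mathlib

open MeasureTheory Set Filter Topology
open scoped ENNReal NNReal

noncomputable section

namespace RISpace

/-- Lebesgue measure on the interval `(0,1)`. Functions on `(0,1)` are represented by functions on
`ℝ` whose values outside `(0,1)` play no role. -/
def unitMeasure : Measure ℝ := volume.restrict (Ioo 0 1)

/-- `f ∈ M(0,1)`: a Lebesgue measurable function on `(0,1)` with values in `[-∞,∞]`. -/
def MemM (f : ℝ → EReal) : Prop := AEMeasurable f unitMeasure

/-- `f ∈ M₊(0,1)`. -/
def MemMPlus (f : ℝ → EReal) : Prop := MemM f ∧ ∀ t ∈ Ioo (0 : ℝ) 1, 0 ≤ f t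

/-- The distribution function `l ↦ |{x ∈ (0,1) : |f x| > l}|`, `l ∈ [0,∞)`. -/
def distribution (f : ℝ → EReal) (l : ℝ≥0) : ℝ≥0∞ :=
  unitMeasure {x | (l : ℝ≥0∞) < (f x).abs}

/-- `f` and `g` have the same distribution function. -/
def Equimeasurable (f g : ℝ → EReal) : Prop := ∀ l : ℝ≥0, distribution f l = distribution g l

/-- The nonincreasing rearrangement
`f* t = inf {l ∈ [0,∞) : distribution f l ≤ t}`, where the infimum of the empty set is `∞`. -/
def rearrangement (f : ℝ → EReal) (t : ℝ) : EReal :=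
  ((⨅ (l : ℝ≥0) (_ : distribution f l ≤ ENNReal.ofReal t), (l : ℝ≥0∞) : ℝ≥0∞) : EReal)

/-- `ρ` is a rearrangement-invariant norm on `M(0,1)`. Only its values on measurable functions
matter. -/
structure IsRINorm (ρ : (ℝ → EReal) → ℝ≥0∞) : Prop where
  eq_zero_iff : ∀ f, MemMPlus f → (ρ f = 0 ↔ ∀ᵐ t ∂unitMeasure, f t = 0)
  smul : ∀ f, MemMPlus f → ∀ a : ℝ≥0, ρ (fun t => ((a : ℝ) : EReal) * f t) = a * ρ f
  add_le : ∀ f g, MemMPlus f → MemMPlus g → ρ (fun t => f t + g t) ≤ ρ f + ρ g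
  mono : ∀ f g, MemMPlus f → MemMPlus g → (∀ᵐ t ∂unitMeasure, f t ≤ g t) → ρ f ≤ ρ g
  fatou : ∀ (F : ℕ → ℝ → EReal) (f : ℝ → EReal), (∀ k, MemMPlus (F k)) → MemMPlus f →
    (∀ᵐ t ∂unitMeasure, Monotone (fun k => F k t) ∧
      Tendsto (fun k => F k t) atTop (𝓝 (f t))) →
    Monotone (fun k => ρ (F k)) ∧ Tendsto (fun k => ρ (F k)) atTop (𝓝 (ρ f))
  one_lt_top : ρ (fun _ => 1) < ∞
  integral_le : ∃ C : ℝ≥0, 0 < C ∧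
    ∀ f, MemMPlus f → ∫⁻ t, (f t).abs ∂unitMeasure ≤ C * ρ f
  rearr : ∀ u v, MemM u → MemM v → Equimeasurable u v → ρ u = ρ v

/-- The closed unit ball of the space of all `f ∈ M(0,1)` with `ρ f < ∞`. -/
def unitBall (ρ : (ℝ → EReal) → ℝ≥0∞) : Set (ℝ → EReal) := {f | MemM f ∧ ρ f ≤ 1}

/-- The spaces given by `ρ` and `σ` consist of the same functions. -/
def SameSpace (ρ σ : (ℝ → EReal) → ℝ≥0∞) : Prop := ∀ f, MemM f → (ρ f < ∞ ↔ σ f < ∞)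

/-- The norm of `L^∞(0,1)`. -/
def normLInfty (f : ℝ → EReal) : ℝ≥0∞ := essSup (fun t => (f t).abs) unitMeasure

/-- The associate norm `f ↦ sup {∫ |f g| : ρ g ≤ 1}`. -/
def associateNorm (ρ : (ℝ → EReal) → ℝ≥0∞) (f : ℝ → EReal) : ℝ≥0∞ :=
  ⨆ g ∈ unitBall ρ, ∫⁻ t, (f t * g t).abs ∂unitMeasure

/-- The almost-compact embedding of the space given by `ρ` into the one given by `σ`. -/
def AlmostCompactEmbedding (ρ σ : (ℝ → EReal) → ℝ≥0∞) : Prop :=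
  ∀ E : ℕ → Set ℝ, (∀ k, E k ⊆ Ioo 0 1) → (∀ k, NullMeasurableSet (E k) volume) →
    (∀ᵐ t ∂unitMeasure, Tendsto (fun k => (E k).indicator (1 : ℝ → ℝ) t) atTop (𝓝 0)) →
    Tendsto (fun k => ⨆ f ∈ unitBall ρ, σ ((E k).indicator f)) atTop (𝓝 0)

/-- The operator `T` is compact from the space given by `ρ` into the one given by `σ`: it maps the
first space into the second one, and every bounded sequence in the first space has a subsequence
whose image converges in norm to an element of the second space. -/
def IsCompactBetween (T : (ℝ → EReal) → ℝ → EReal) (ρ σ : (ℝ → EReal) → ℝ≥0∞) : Prop :=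
  (∀ f, MemM f → ρ f < ∞ → MemM (T f) ∧ σ (T f) < ∞) ∧
  ∀ F : ℕ → ℝ → EReal, (∀ k, MemM (F k)) → (∃ C : ℝ≥0, ∀ k, ρ (F k) ≤ C) →
    ∃ g : ℝ → EReal, MemM g ∧ σ g < ∞ ∧ ∃ φ : ℕ → ℕ, StrictMono φ ∧
      Tendsto (fun k => σ (fun t => T (F (φ k)) t - g t)) atTop (𝓝 0)

/-- `H_J f (t) = ∫_t^1 |f(s)| / J(s) ds`. -/
def opH (J : ℝ → ℝ) (f : ℝ → EReal) (t : ℝ) : EReal :=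
  ((∫⁻ s in Ioo t 1, (f s).abs / ENNReal.ofReal (J s) : ℝ≥0∞) : EReal)

/-- `R_J f (t) = (1 / J(t)) ∫_0^t |f(s)| ds`. -/
def opR (J : ℝ → ℝ) (f : ℝ → EReal) (t : ℝ) : EReal :=
  (((∫⁻ s in Ioo 0 t, (f s).abs) / ENNReal.ofReal (J t) : ℝ≥0∞) : EReal)

/-- `H_J^j = H_J ∘ ⋯ ∘ H_J`. -/
def opHPow (J : ℝ → ℝ) (j : ℕ) : (ℝ → EReal) → ℝ → EReal := (opH J)^[j]

/-- `R_J^j = R_J ∘ ⋯ ∘ R_J`. -/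
def opRPow (J : ℝ → ℝ) (j : ℕ) : (ℝ → EReal) → ℝ → EReal := (opR J)^[j]

/-- The norm `f ↦ ‖R_J^j f*‖_{X'}`, where `X'` is the associate space of `X`. -/
def rangeNormDual (J : ℝ → ℝ) (j : ℕ) (X : (ℝ → EReal) → ℝ≥0∞) (f : ℝ → EReal) : ℝ≥0∞ :=
  associateNorm X (opRPow J j (rearrangement f))

/-- The optimal range norm for `X` with respect to `H_J^j`: the associate norm of
`rangeNormDual J j X`. -/
def rangeNorm (J : ℝ → ℝ) (j : ℕ) (X : (ℝ → EReal) → ℝ≥0∞) : (ℝ → EReal) → ℝ≥0∞ :=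
  associateNorm (rangeNormDual J j X)

end RISpace

end

namespace RISpace

/-! All three conditions are compared with (ii), the uniform smallness of the images near the origin
(`SmallTails`). Norms and operators see only absolute values, so the work is done with values in
`[0,∞]`, with `w = 1/J` and with the adjoint pair H = `hardyH w`, R = `hardyR w`.

(ii) ⇒ (i). The functions `H^j f` are nonincreasing and, since `w(t) ≤ c/t`, uniformly bounded on
`[a,1)` when `f` runs through a bounded set of X. Helly's theorem gives a subsequence converging
a.e. Near 0 the tails are small; on `[a,1)` the convergence is bounded and in measure, which
suffices because the fundamental function of Y vanishes at 0, itself a consequence of (ii)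
(`exists_subseq_tendsto_of_tail`).

(i) ⇒ (ii). Take functions in the unit ball whose supports shrink to 0. At each point their images
are eventually 0, so 0 is the only possible limit; by compactness the images of functions supported
in `(0,b)` are uniformly small for some `b`. The remaining part of `f`, on `[b,1)`, has bounded
image under H, hence its image under `H^j` is at most `K H^(j-1) 1`. The alternative in the
hypotheses makes the tail of this single function small: if `∫ w = ∞`, it is `o(H^j 1)` with `H^j 1`
in Y; otherwise it is bounded, and Y ≠ L^∞ forces the fundamental function of Y to vanish at 0
(`exists_tail_le_of_compact`).

(ii) ⇔ (iii) is duality. By Hardy–Littlewood, `H^j` maps the unit ball of X into that of the range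
space, so (iii) on the sets `(0,a)` gives (ii). Conversely, if `|E| ≤ a`, then `(χ_E g)* ≤ χ_(0,a)
g*`; adjointness moves `R^j` onto the other factor, producing `χ_(0,a) H^j u`, and the
Lorentz–Luxemburg theorem turns the bounds on pairings into a norm bound
(`IsRINormENN.indicator_le_of_rangeENN`). The factor `g*` is handled by a measure preserving `σ`
with `g* ∘ σ ≤ g`. -/

/-! ### Reduction to norms on functions with values in `[0,∞]`. -/

instance : IsProbabilityMeasure unitMeasure := ⟨by simp [unitMeasure]⟩

lemma ae_mem_Ioo : ∀ᵐ t ∂unitMeasure, t ∈ Ioo (0 : ℝ) 1 :=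
  ae_restrict_mem measurableSet_Ioo

/-- Rearrangement-invariant norms, as functionals of functions with values in `[0,∞]`. -/
structure IsRINormENN (N : (ℝ → ℝ≥0∞) → ℝ≥0∞) : Prop where
  eq_zero_iff : ∀ u, AEMeasurable u unitMeasure → (N u = 0 ↔ u =ᵐ[unitMeasure] 0)
  smul : ∀ u, AEMeasurable u unitMeasure → ∀ a : ℝ≥0, N (fun t => a * u t) = a * N u
  add_le : ∀ u v, AEMeasurable u unitMeasure → AEMeasurable v unitMeasure →
    N (fun t => u t + v t) ≤ N u + N v
  mono : ∀ u v, AEMeasurable u unitMeasure → AEMeasurable v unitMeasure →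
    u ≤ᵐ[unitMeasure] v → N u ≤ N v
  iSup : ∀ u : ℕ → ℝ → ℝ≥0∞, (∀ n, AEMeasurable (u n) unitMeasure) →
    (∀ t, Monotone fun n => u n t) → N (fun t => ⨆ n, u n t) = ⨆ n, N (u n)
  one_lt_top : N (fun _ => 1) < ∞
  integral_le : ∃ C : ℝ≥0, ∀ u, AEMeasurable u unitMeasure → ∫⁻ t, u t ∂unitMeasure ≤ C * N u
  rearr : ∀ u v, AEMeasurable u unitMeasure → AEMeasurable v unitMeasure →
    (∀ l : ℝ≥0, unitMeasure {x | (l : ℝ≥0∞) < u x} = unitMeasure {x | (l : ℝ≥0∞) < v x}) →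
    N u = N v

/-- The functional that `ρ` induces on functions with values in `[0,∞]`. -/
noncomputable def posNorm (ρ : (ℝ → EReal) → ℝ≥0∞) (u : ℝ → ℝ≥0∞) : ℝ≥0∞ := ρ fun t => (u t : EReal)

lemma abs_coe_ennreal (x : ℝ≥0∞) : (x : EReal).abs = x := by
  induction x with
  | top => rfl
  | coe x =>
    change ((x : ℝ) : EReal).abs = x
    rw [EReal.abs_def, abs_of_nonneg x.coe_nonneg, ENNReal.ofReal_coe_nnreal]

lemma measurable_abs : Measurable EReal.abs :=
  EReal.measurable_of_measurable_real (by
    change Measurable fun x : ℝ => ENNReal.ofReal |x|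
    fun_prop)

lemma MemM.abs {f : ℝ → EReal} (hf : MemM f) : AEMeasurable (fun t => (f t).abs) unitMeasure :=
  measurable_abs.comp_aemeasurable hf

lemma memM_coe {u : ℝ → ℝ≥0∞} (hu : AEMeasurable u unitMeasure) :
    MemM fun t => (u t : EReal) :=
  measurable_coe_ennreal_ereal.comp_aemeasurable hu

lemma memMPlus_coe {u : ℝ → ℝ≥0∞} (hu : AEMeasurable u unitMeasure) :
    MemMPlus fun t => (u t : EReal) :=
  ⟨memM_coe hu, fun _ _ => EReal.coe_ennreal_nonneg _⟩

/-- `f` and `|f|` are equimeasurable. This is what confines the whole argument to nonnegative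
functions. -/
lemma IsRINorm.eq_posNorm_abs {ρ : (ℝ → EReal) → ℝ≥0∞} (hρ : IsRINorm ρ) {f : ℝ → EReal}
    (hf : MemM f) : ρ f = posNorm ρ fun t => (f t).abs :=
  hρ.rearr _ _ hf (memM_coe hf.abs) fun l => by simp only [distribution, abs_coe_ennreal]

lemma IsRINorm.posNorm {ρ : (ℝ → EReal) → ℝ≥0∞} (hρ : IsRINorm ρ) :
    IsRINormENN (posNorm ρ) where
  eq_zero_iff u hu := by
    refine (hρ.eq_zero_iff _ (memMPlus_coe hu)).trans ?_
    simp only [EReal.coe_ennreal_eq_zero]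
    rfl
  smul u hu a := by
    rw [RISpace.posNorm, RISpace.posNorm, ← hρ.smul _ (memMPlus_coe hu)]
    congr 1
    ext t
    rw [EReal.coe_ennreal_mul]
    rfl
  add_le u v hu hv := by
    have := hρ.add_le _ _ (memMPlus_coe hu) (memMPlus_coe hv)
    simpa only [RISpace.posNorm, EReal.coe_ennreal_add] using this
  mono u v hu hv h := hρ.mono _ _ (memMPlus_coe hu) (memMPlus_coe hv) (by
    filter_upwards [h] with t ht using EReal.coe_ennreal_le_coe_ennreal_iff.2 ht)
  iSup u hu hmon := by
    have hs : AEMeasurable (fun t => ⨆ n, u n t) unitMeasure := .iSup hu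
    obtain ⟨h1, h2⟩ := hρ.fatou (fun n t => (u n t : EReal)) (fun t => ((⨆ n, u n t : ℝ≥0∞) : EReal))
      (fun k => memMPlus_coe (hu k)) (memMPlus_coe hs) (.of_forall fun t =>
        ⟨fun m n hmn => EReal.coe_ennreal_le_coe_ennreal_iff.2 (hmon t hmn),
        (continuous_coe_ennreal_ereal.tendsto _).comp (tendsto_atTop_iSup (hmon t))⟩)
    exact tendsto_nhds_unique h2 (tendsto_atTop_iSup h1)
  one_lt_top := by simpa [RISpace.posNorm] using hρ.one_lt_top
  integral_le := by
    obtain ⟨C, -, h⟩ := hρ.integral_le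
    exact ⟨C, fun u hu => by
      simpa only [abs_coe_ennreal] using! h _ (memMPlus_coe hu)⟩
  rearr u v hu hv h := hρ.rearr _ _ (memM_coe hu) (memM_coe hv) fun l => by
    simpa only [distribution, abs_coe_ennreal] using h l

/-! ### The Fatou property and Lorentz–Luxemburg duality. -/

namespace IsRINormENN

variable {N : (ℝ → ℝ≥0∞) → ℝ≥0∞}

lemma congr (hN : IsRINormENN N) {u v : ℝ → ℝ≥0∞} (hu : AEMeasurable u unitMeasure)
    (h : u =ᵐ[unitMeasure] v) : N u = N v :=
  le_antisymm (hN.mono _ _ hu (hu.congr h) h.le) (hN.mono _ _ (hu.congr h) hu h.symm.le)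

lemma const_lt_top (hN : IsRINormENN N) (c : ℝ≥0) : N (fun _ => c) < ∞ := by
  have h := hN.smul (fun _ => 1) aemeasurable_const c
  simp only [mul_one] at h
  rw [h]
  exact ENNReal.mul_lt_top ENNReal.coe_lt_top hN.one_lt_top

/-- The Fatou property of a rearrangement-invariant norm. -/
lemma le_of_tendsto (hN : IsRINormENN N) {u : ℕ → ℝ → ℝ≥0∞} {v : ℝ → ℝ≥0∞} {c : ℝ≥0∞}
    (hu : ∀ n, AEMeasurable (u n) unitMeasure)
    (h : ∀ᵐ t ∂unitMeasure, Tendsto (fun n => u n t) atTop (𝓝 (v t))) (hc : ∀ n, N (u n) ≤ c) :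
    N v ≤ c := by
  -- The limit is a.e. the increasing supremum of the tail infima, to which the monotone axiom
  -- `iSup` applies.
  have hw : ∀ n, AEMeasurable (fun t => ⨅ i, u (n + i) t) unitMeasure :=
    fun n => .iInf fun i => hu (n + i)
  have hmon : ∀ t, Monotone fun n => ⨅ i, u (n + i) t := fun t m n hmn =>
    le_iInf fun i => (iInf_le _ (n - m + i)).trans_eq (by congr 1; omega)
  have hv : (fun t => ⨆ n, ⨅ i, u (n + i) t) =ᵐ[unitMeasure] v := by
    filter_upwards [h] with t ht
    have := ht.liminf_eq
    rw [liminf_eq_iSup_iInf_of_nat'] at this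
    simpa only [add_comm] using this
  rw [← hN.congr (.iSup hw) hv, hN.iSup _ hw hmon]
  refine iSup_le fun n => (hN.mono _ _ (hw n) (hu n) (.of_forall fun t => ?_)).trans (hc n)
  exact (iInf_le _ 0)

/-- The Lorentz–Luxemburg theorem: a rearrangement-invariant norm is determined by its associate
norm. -/
theorem le_one_of_forall_dual (hN : IsRINormENN N) {u : ℝ → ℝ≥0∞}
    (hu : AEMeasurable u unitMeasure)
    (h : ∀ v, AEMeasurable v unitMeasure →
      (∀ w, AEMeasurable w unitMeasure → N w ≤ 1 → ∫⁻ t, w t * v t ∂unitMeasure ≤ 1) →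
      ∫⁻ t, u t * v t ∂unitMeasure ≤ 1) : N u ≤ 1 := by
  by_contra! hlt
  have trunc_meas : ∀ w : ℝ → ℝ≥0∞, AEMeasurable w unitMeasure → ∀ n : ℕ,
      AEMeasurable (fun t => min (w t) n) unitMeasure := fun w hw n => hw.min aemeasurable_const
  have trunc_mono : ∀ (w : ℝ → ℝ≥0∞) t, Monotone fun n : ℕ => min (w t) n :=
    fun w t m n hmn => min_le_min_left _ (by exact_mod_cast hmn)
  have trunc_sup : ∀ (w : ℝ → ℝ≥0∞) t, ⨆ n : ℕ, min (w t) n = w t := fun w t => by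
    rw [← inf_iSup_eq, ENNReal.iSup_natCast, inf_top_eq]
  have memLp : ∀ w : ℝ → ℝ≥0∞, AEMeasurable w unitMeasure → ∀ n : ℕ, ∀ s : ℝ → ℝ,
      AEMeasurable s unitMeasure → (∀ t, |s t| ≤ 1) →
      MemLp (fun t => s t * (min (w t) n).toReal) 2 unitMeasure := fun w hw n s hs hs1 => by
    refine MemLp.of_bound (C := n) (hs.mul (trunc_meas w hw n).ennreal_toReal).aestronglyMeasurable
      (.of_forall fun t => ?_)
    rw [Real.norm_eq_abs, abs_mul, abs_of_nonneg ENNReal.toReal_nonneg]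
    have : (min (w t) n).toReal ≤ n := ENNReal.toReal_le_of_le_ofReal n.cast_nonneg (by simp)
    exact (mul_le_of_le_one_left ENNReal.toReal_nonneg (hs1 t)).trans this
  -- A bounded truncation of `u` still has norm above 1 and belongs to L², where continuous
  -- functionals are again functions.
  obtain ⟨n, hn⟩ : ∃ n : ℕ, 1 < N (fun t => min (u t) n) := by
    have := hN.iSup _ (trunc_meas u hu) (trunc_mono u)
    simp only [trunc_sup] at this
    rw [this] at hlt
    exact lt_iSup_iff.1 hlt
  -- The trace of the unit ball on L² is convex, and closed by the Fatou property. Hahn–Banach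
  -- separates the truncation from it by some `V` at level `α`, and `|V| / α` then violates `h`.
  let S : Set (Lp ℝ 2 unitMeasure) := {f | N (fun t => ‖f t‖ₑ) ≤ 1}
  have hmeas : ∀ f : Lp ℝ 2 unitMeasure, AEMeasurable (fun t => ‖f t‖ₑ) unitMeasure :=
    fun f => (Lp.aestronglyMeasurable f).enorm
  have hconv : Convex ℝ S := by
    intro f hf g hg a b ha hb hab
    have h1 := hN.add_le (fun t => (a.toNNReal : ℝ≥0∞) * ‖f t‖ₑ)
      (fun t => (b.toNNReal : ℝ≥0∞) * ‖g t‖ₑ)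
      ((hmeas f).const_mul _) ((hmeas g).const_mul _)
    rw [hN.smul _ (hmeas f), hN.smul _ (hmeas g)] at h1
    refine (hN.mono _ _ (hmeas _) (((hmeas f).const_mul _).add ((hmeas g).const_mul _)) ?_).trans
      (h1.trans ?_)
    · filter_upwards [Lp.coeFn_add (a • f) (b • g), Lp.coeFn_smul a f, Lp.coeFn_smul b g]
        with t h1 h2 h3
      rw [h1, Pi.add_apply, h2, h3, Pi.smul_apply, Pi.smul_apply]
      refine (enorm_add_le _ _).trans ?_
      rw [enorm_smul, enorm_smul, Real.enorm_of_nonneg ha, Real.enorm_of_nonneg hb]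
      rfl
    · calc _ ≤ (a.toNNReal : ℝ≥0∞) * 1 + (b.toNNReal : ℝ≥0∞) * 1 := by gcongr <;> assumption
        _ = 1 := by
          rw [mul_one, mul_one, ← ENNReal.coe_add, ← Real.toNNReal_add ha hb, hab]
          simp
  have hclosed : IsClosed S := by
    refine IsSeqClosed.isClosed fun f g hf hfg => ?_
    obtain ⟨ns, -, hns⟩ := (tendstoInMeasure_of_tendsto_Lp hfg).exists_seq_tendsto_ae
    refine hN.le_of_tendsto (u := fun k t => ‖f (ns k) t‖ₑ) (fun k => hmeas _) ?_ fun k => hf _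
    filter_upwards [hns] with t ht using ht.enorm
  let U : Lp ℝ 2 unitMeasure := (memLp u hu n (fun _ => 1) aemeasurable_const (by simp)).toLp _
  have hU : U =ᵐ[unitMeasure] fun t => 1 * (min (u t) n).toReal := MemLp.coeFn_toLp _
  have enorm_trunc : ∀ (w : ℝ → ℝ≥0∞) t (n : ℕ), ‖(min (w t) n).toReal‖ₑ = min (w t) n := by
    intro w t n
    rw [Real.enorm_of_nonneg ENNReal.toReal_nonneg, ENNReal.ofReal_toReal]
    exact ne_top_of_le_ne_top (ENNReal.natCast_ne_top n) (min_le_right _ _)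
  have hUS : U ∉ S := fun hmem => by
    refine hn.not_ge (le_of_eq_of_le (hN.congr (trunc_meas u hu n) ?_) hmem)
    filter_upwards [hU] with t ht
    rw [ht, one_mul, enorm_trunc]
  obtain ⟨φ, α, hφS, hφU⟩ := geometric_hahn_banach_closed_point hconv hclosed hUS
  let V : Lp ℝ 2 unitMeasure := (InnerProductSpace.toDual ℝ _).symm φ
  have hφ : ∀ f : Lp ℝ 2 unitMeasure, φ f = ∫ t, f t * V t ∂unitMeasure := fun f => by
    rw [← InnerProductSpace.toDual_symm_apply, L2.inner_def]
    rfl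
  have hint : ∀ f : Lp ℝ 2 unitMeasure, Integrable (fun t => f t * V t) unitMeasure :=
    fun f => L2.integrable_inner V f
  have hα : 0 < α := by
    have h0 : (0 : Lp ℝ 2 unitMeasure) ∈ S := by
      have : N (fun t => ‖(0 : Lp ℝ 2 unitMeasure) t‖ₑ) = 0 := by
        rw [hN.eq_zero_iff _ (hmeas _)]
        filter_upwards [Lp.coeFn_zero ℝ 2 unitMeasure] with t ht
        simp
      exact this.le.trans zero_le_one
    simpa using hφS 0 h0
  have hα' : ENNReal.ofReal α ≠ 0 := by simpa using hα
  have hVm : AEMeasurable V unitMeasure := (Lp.aestronglyMeasurable V).aemeasurable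
  have hvm : AEMeasurable (fun t => ‖V t‖ₑ / ENNReal.ofReal α) unitMeasure :=
    (hmeas V).div_const _
  have hlow : ENNReal.ofReal α < ∫⁻ t, u t * ‖V t‖ₑ ∂unitMeasure := by
    refine ((ENNReal.ofReal_lt_ofReal_iff (hα.trans hφU)).2 hφU).trans_le ?_
    rw [hφ]
    refine (ENNReal.ofReal_le_ofReal (le_abs_self _)).trans ?_
    rw [← Real.enorm_eq_ofReal_abs]
    refine (enorm_integral_le_lintegral_enorm _).trans (lintegral_mono_ae ?_)
    filter_upwards [hU] with t ht
    rw [enorm_mul, ht, one_mul, enorm_trunc]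
    gcongr
    exact min_le_left _ _
  have hup : ∀ w, AEMeasurable w unitMeasure → N w ≤ 1 →
      ∫⁻ t, w t * ‖V t‖ₑ ∂unitMeasure ≤ ENNReal.ofReal α := by
    intro w hw hw1
    have hsup : ∀ t, w t * ‖V t‖ₑ = ⨆ m : ℕ, min (w t) m * ‖V t‖ₑ := fun t => by
      rw [← ENNReal.iSup_mul, trunc_sup]
    simp only [hsup]
    rw [lintegral_iSup' (f := fun (m : ℕ) t => min (w t) m * ‖V t‖ₑ) (fun m => (trunc_meas w hw m).mul (hmeas V))
      (.of_forall fun t i j hij => mul_le_mul_left (trunc_mono w t hij) _)]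
    refine iSup_le fun m => ?_
    -- Multiplication by the sign of `V` keeps the truncated `w` in `S` and replaces `V` by `|V|` in
    -- the pairing.
    have hsm : Measurable fun r : ℝ => if 0 ≤ r then (1 : ℝ) else -1 :=
      Measurable.ite measurableSet_Ici measurable_const measurable_const
    have hf := memLp w hw m (fun t => if 0 ≤ V t then (1 : ℝ) else -1)
      (hsm.comp_aemeasurable hVm) (fun t => by split_ifs <;> simp)
    have hfS : hf.toLp _ ∈ S := by
      refine (hN.mono _ _ (hmeas _) hw ?_).trans hw1
      filter_upwards [hf.coeFn_toLp] with t ht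
      rw [ht, enorm_mul, enorm_trunc]
      refine le_trans (le_of_eq ?_) (min_le_left (w t) (m : ℝ≥0∞))
      split_ifs <;> simp
    have hfV : (fun t => hf.toLp _ t * V t) =ᵐ[unitMeasure]
        fun t => (min (w t) m).toReal * ‖V t‖ := by
      filter_upwards [hf.coeFn_toLp] with t ht
      rw [ht, Real.norm_eq_abs]
      split_ifs with h0
      · rw [abs_of_nonneg h0]; ring
      · rw [abs_of_neg (not_le.1 h0)]; ring
    have h1 := hφS _ hfS
    rw [hφ, integral_congr_ae hfV] at h1
    refine le_trans (le_of_eq ?_) (ENNReal.ofReal_le_ofReal h1.le)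
    rw [ofReal_integral_eq_lintegral_ofReal ((hint _).congr hfV)
      (.of_forall fun t => by positivity)]
    refine lintegral_congr fun t => ?_
    rw [ENNReal.ofReal_mul ENNReal.toReal_nonneg, ofReal_norm,
      ← Real.enorm_of_nonneg ENNReal.toReal_nonneg, enorm_trunc]
  have hdiv : ∀ w : ℝ → ℝ≥0∞, ∫⁻ t, w t * (‖V t‖ₑ / ENNReal.ofReal α) ∂unitMeasure =
      (∫⁻ t, w t * ‖V t‖ₑ ∂unitMeasure) / ENNReal.ofReal α := fun w => by
    simp only [div_eq_mul_inv, ← mul_assoc]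
    exact lintegral_mul_const' _ _ (ENNReal.inv_ne_top.2 hα')
  have := h _ hvm fun w hw hw1 => by
    rw [hdiv]
    exact ENNReal.div_le_of_le_mul (by simpa using hup w hw hw1)
  rw [hdiv, ENNReal.div_le_iff hα' ENNReal.ofReal_ne_top, one_mul] at this
  exact hlow.not_ge this

end IsRINormENN
-- Rearrangements and the measure preserving rank map.
/-- The nonincreasing rearrangement of a function with values in `[0,∞]`. -/
noncomputable def rearrENN (u : ℝ → ℝ≥0∞) (t : ℝ) : ℝ≥0∞ :=
  ⨅ (l : ℝ≥0) (_ : unitMeasure {x | (l : ℝ≥0∞) < u x} ≤ ENNReal.ofReal t), (l : ℝ≥0∞)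

lemma rearrENN_congr {u v : ℝ → ℝ≥0∞} (h : u =ᵐ[unitMeasure] v) : rearrENN u = rearrENN v := by
  have : ∀ l : ℝ≥0, unitMeasure {x | (l : ℝ≥0∞) < u x} = unitMeasure {x | (l : ℝ≥0∞) < v x} :=
    fun l => measure_congr (eventuallyEq_set.2 (by
      filter_upwards [h] with t ht
      simp only [ht]))
  ext t
  simp only [rearrENN, this]

lemma antitone_rearrENN (u : ℝ → ℝ≥0∞) : Antitone (rearrENN u) := fun _ _ hst =>
  le_iInf₂ fun l hl => iInf₂_le l (hl.trans (ENNReal.ofReal_le_ofReal hst))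

lemma measurable_rearrENN (u : ℝ → ℝ≥0∞) : Measurable (rearrENN u) :=
  (antitone_rearrENN u).measurable

/-- The sets `{u > r}` increase to `{u > l}` as `r` decreases to `l`; this right continuity makes
the distribution function and the rearrangement generalized inverses of each other. -/
lemma lt_rearrENN_iff {u : ℝ → ℝ≥0∞} {t : ℝ} {l : ℝ≥0} :
    (l : ℝ≥0∞) < rearrENN u t ↔ ENNReal.ofReal t < unitMeasure {x | (l : ℝ≥0∞) < u x} := by
  refine ⟨fun h => ?_, fun h => ?_⟩
  · contrapose! h
    exact iInf₂_le l h
  · contrapose! h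
    obtain ⟨r, hr, hrl, hrt⟩ := exists_seq_strictAnti_tendsto l
    have hset : {x | (l : ℝ≥0∞) < u x} = ⋃ n, {x | (r n : ℝ≥0∞) < u x} := by
      ext x
      simp only [mem_ofPred_eq, mem_iUnion]
      refine ⟨fun hx => ?_, fun ⟨n, hn⟩ => lt_of_le_of_lt (by exact_mod_cast (hrl n).le) hn⟩
      exact (((ENNReal.tendsto_coe.2 hrt).eventually (gt_mem_nhds hx))).exists
    have hmon : Monotone fun n => {x | (r n : ℝ≥0∞) < u x} := fun m n hmn x (hx : _ < _) =>
      lt_of_le_of_lt (ENNReal.coe_le_coe.2 (hr.antitone hmn)) hx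
    rw [hset, hmon.measure_iUnion]
    refine iSup_le fun n => ?_
    obtain ⟨l', h1, h2⟩ : ∃ l' : ℝ≥0, unitMeasure {x | (l' : ℝ≥0∞) < u x} ≤ ENNReal.ofReal t ∧
        (l' : ℝ≥0∞) < r n := by
      have : rearrENN u t < r n := h.trans_lt (by exact_mod_cast hrl n)
      simpa [rearrENN, iInf_lt_iff] using this
    exact (measure_mono fun x hx => h2.trans hx).trans h1

lemma measure_le_of_rearrENN {u : ℝ → ℝ≥0∞} (t : ℝ) :
    unitMeasure {x | rearrENN u t < u x} ≤ ENNReal.ofReal t := by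
  by_cases h : rearrENN u t = ∞
  · simp [h]
  · lift rearrENN u t to ℝ≥0 using h with l hl
    exact not_lt.1 fun h => (lt_rearrENN_iff.2 h).ne hl

lemma le_measure_of_rearrENN {u : ℝ → ℝ≥0∞} (hu : Measurable u) {t : ℝ} (ht : t ≤ 1) :
    ENNReal.ofReal t ≤ unitMeasure {x | rearrENN u t ≤ u x} := by
  rcases eq_or_ne (rearrENN u t) 0 with h0 | h0
  · simpa [h0] using ht
  obtain ⟨r, hr, hrl, hrt⟩ := exists_seq_strictMono_tendsto' (pos_iff_ne_zero.2 h0)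
  have hset : {x | rearrENN u t ≤ u x} = ⋂ n, {x | r n < u x} := by
    ext x
    simp only [mem_ofPred_eq, mem_iInter]
    exact ⟨fun hx n => (hrl n).2.trans_le hx, fun h => le_of_tendsto' hrt fun n => (h n).le⟩
  have hanti : Antitone fun n => {x | r n < u x} := fun m n hmn x hx =>
    (hr.monotone hmn).trans_lt hx
  rw [hset, hanti.measure_iInter
    (fun n => (measurableSet_lt measurable_const hu).nullMeasurableSet) ⟨0, measure_ne_top _ _⟩]
  refine le_iInf fun n => ?_
  have hn : r n ≠ ∞ := ((hrl n).2.trans_le le_top).ne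
  have := (hrl n).2
  lift r n to ℝ≥0 using hn with l
  exact (lt_rearrENN_iff.1 this).le

lemma unitMeasure_Iic {t : ℝ} (ht1 : t ≤ 1) : unitMeasure (Iic t) = ENNReal.ofReal t := by
  have h : (Iic t ∩ Ioo 0 1 : Set ℝ) =ᵐ[volume] Ioc 0 t := by
    have h1 : (Iic t ∩ Ioo 0 1 : Set ℝ) =ᵐ[volume] (Iic t ∩ Ioc 0 1 : Set ℝ) :=
      (ae_eq_refl (Iic t : Set ℝ)).inter Ioo_ae_eq_Ioc
    have h2 : (Iic t ∩ Ioc 0 1 : Set ℝ) = Ioc 0 t := by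
      ext x
      simp only [mem_inter_iff, mem_Iic, mem_Ioc]
      exact ⟨fun h => ⟨h.2.1, h.1⟩, fun h => ⟨h.2, h.1, h.2.trans ht1⟩⟩
    rwa [h2] at h1
  rw [unitMeasure, Measure.restrict_apply measurableSet_Iic, measure_congr h, Real.volume_Ioc,
    sub_zero]

/-- The points that precede `x` when `(0,1)` is ordered by decreasing values of `u`. -/
def precede (u : ℝ → ℝ≥0∞) (x : ℝ) : Set ℝ := {y | u x < u y ∨ u y = u x ∧ y < x}

/-- A measure preserving map `σ` with `u = u* ∘ σ`. -/
noncomputable def rank (u : ℝ → ℝ≥0∞) (x : ℝ) : ℝ := unitMeasure.real (precede u x)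

lemma measurable_rank {u : ℝ → ℝ≥0∞} (hu : Measurable u) : Measurable (rank u) := by
  have hS : MeasurableSet {p : ℝ × ℝ | u p.1 < u p.2 ∨ u p.2 = u p.1 ∧ p.2 < p.1} :=
    (measurableSet_lt (hu.comp measurable_fst) (hu.comp measurable_snd)).union
      ((measurableSet_eq_fun (hu.comp measurable_snd) (hu.comp measurable_fst)).inter
        (measurableSet_lt measurable_snd measurable_fst))
  exact (measurable_measure_prodMk_left hS).ennreal_toReal

/-- All points where `u` exceeds `u x` precede `x`, so `u x` is an admissible level at `rank u x`.
Only this half of `u = u* ∘ σ` is needed. -/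
lemma rearrENN_rank_le (u : ℝ → ℝ≥0∞) (x : ℝ) : rearrENN u (rank u x) ≤ u x := by
  by_cases h : u x = ∞
  · simp [h]
  · have hx : u x = (u x).toNNReal := (ENNReal.coe_toNNReal h).symm
    rw [hx]
    refine iInf₂_le _ ?_
    rw [rank, ofReal_measureReal]
    refine measure_mono fun y hy => Or.inl ?_
    rw [hx]
    exact hy

/-- The measure is a 1-Lipschitz function of `x`, so the intermediate value theorem applies between
0 and 1. -/
lemma exists_measure_inter_Iio {s : Set ℝ} {r : ℝ} (h0 : 0 ≤ r) (h1 : r ≤ unitMeasure.real s) :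
    ∃ x, unitMeasure.real (s ∩ Iio x) = r := by
  have hlip : LipschitzWith 1 fun x => unitMeasure.real (s ∩ Iio x) := by
    refine LipschitzWith.of_le_add fun x y => ?_
    have h1 : s ∩ Iio x ⊆ (s ∩ Iio y) ∪ Ico y x := fun z ⟨hz, hzx⟩ =>
      (lt_or_ge z y).imp (fun h => ⟨hz, h⟩) fun h => ⟨h, hzx⟩
    have h2 : unitMeasure.real (Ico y x) ≤ dist x y := by
      refine ENNReal.toReal_le_of_le_ofReal dist_nonneg ?_
      calc unitMeasure (Ico y x) ≤ volume (Ico y x) := Measure.restrict_apply_le _ _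
        _ = ENNReal.ofReal (x - y) := Real.volume_Ico
        _ ≤ _ := ENNReal.ofReal_le_ofReal (le_abs_self _)
    exact (measureReal_mono h1).trans ((measureReal_union_le _ _).trans (by gcongr))
  have h00 : unitMeasure.real (s ∩ Iio 0) = 0 := by
    rw [measureReal_eq_zero_iff]
    refine measure_mono_null inter_subset_right ?_
    rw [unitMeasure, Measure.restrict_apply measurableSet_Iio]
    convert measure_empty (μ := (volume : Measure ℝ))
    ext x
    simp only [mem_inter_iff, mem_Iio, mem_Ioo, mem_empty_iff_false, iff_false]
    intro h
    exact lt_asymm h.1 h.2.1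
  have h11 : unitMeasure.real (s ∩ Iio 1) = unitMeasure.real s := by
    refine measureReal_congr (eventuallyEq_set.2 ?_)
    filter_upwards [ae_mem_Ioo] with x hx
    exact ⟨fun h => h.1, fun h => ⟨h, hx.2⟩⟩
  obtain ⟨x, -, hx⟩ := intermediate_value_Icc zero_le_one hlip.continuous.continuousOn
    (show r ∈ Icc (unitMeasure.real (s ∩ Iio 0)) (unitMeasure.real (s ∩ Iio 1)) by
      rw [h00, h11]; exact ⟨h0, h1⟩)
  exact ⟨x, hx⟩

/-- With `l = u*(t)`, the set `D` is `{u > l}` completed by a left part of the plateau `{u = l}` to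
measure exactly `t`. It is an initial segment for the order behind `precede`: points outside `D` are
preceded by all of `D`, and points of `D` only by points of `D`. -/
lemma exists_level_set {u : ℝ → ℝ≥0∞} (hu : Measurable u) {t : ℝ} (h0 : 0 ≤ t) (h1 : t ≤ 1) :
    ∃ D, unitMeasure.real D = t ∧ {x | rank u x < t} ⊆ D ∧ D ⊆ {x | rank u x ≤ t} := by
  set l := rearrENN u t
  have hA : unitMeasure.real {x | l < u x} ≤ t :=
    ENNReal.toReal_le_of_le_ofReal h0 (measure_le_of_rearrENN t)
  have hB : t ≤ unitMeasure.real {x | l ≤ u x} := by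
    rw [measureReal_def, ← ENNReal.ofReal_le_iff_le_toReal (measure_ne_top _ _)]
    exact le_measure_of_rearrENN hu h1
  have hms : MeasurableSet {x | u x = l} := measurableSet_eq_fun hu measurable_const
  have hdisj : Disjoint {x | l < u x} {x | u x = l} :=
    Set.disjoint_left.2 fun x hx hx' => hx.ne' hx'
  have hB' : {x | l ≤ u x} = {x | l < u x} ∪ {x | u x = l} := by
    ext x
    simp only [mem_ofPred_eq, mem_union, le_iff_lt_or_eq, eq_comm]
  rw [hB', measureReal_union hdisj hms] at hB
  obtain ⟨x₀, hx₀⟩ := exists_measure_inter_Iio (sub_nonneg.2 hA) (sub_le_iff_le_add'.2 hB)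
  have hD : unitMeasure.real ({x | l < u x} ∪ ({x | u x = l} ∩ Iio x₀)) = t := by
    rw [measureReal_union (hdisj.mono_right inter_subset_left) (hms.inter measurableSet_Iio), hx₀]
    ring
  refine ⟨_, hD, fun x hx => ?_, fun x hx => ?_⟩
  · by_contra hxD
    refine (not_le.2 hx) (hD.symm.le.trans (measureReal_mono ?_))
    simp only [mem_union, mem_ofPred_eq, mem_inter_iff, mem_Iio, not_or, not_lt, not_and] at hxD
    rintro y (hy | ⟨hy, hyx⟩)
    · exact Or.inl (hxD.1.trans_lt hy)
    · rcases hxD.1.lt_or_eq with h | h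
      · exact Or.inl (h.trans_eq hy.symm)
      · exact Or.inr ⟨hy.trans h.symm, hyx.trans_le (hxD.2 h)⟩
  · refine (measureReal_mono ?_).trans hD.le
    rintro y (hy | ⟨hy, hyx⟩)
    · rcases hx with hx | hx
      · exact Or.inl (lt_trans hx hy)
      · exact Or.inl (hx.1.symm.trans_lt hy)
    · rcases hx with hx | hx
      · exact Or.inl (lt_of_lt_of_eq hx hy.symm)
      · exact Or.inr ⟨hy.trans hx.1, hyx.trans hx.2⟩

/-- Ties in `precede` are broken by position, so plateaus of `u` create no atoms: `{rank ≤ t}`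
contains a set of measure `t` and lies in sets of measure `s` for every `s` in `(t,1]`. -/
lemma measurePreserving_rank {u : ℝ → ℝ≥0∞} (hu : Measurable u) :
    MeasurePreserving (rank u) unitMeasure unitMeasure := by
  refine ⟨measurable_rank hu, ?_⟩
  have : IsFiniteMeasure (unitMeasure.map (rank u)) := Measure.isFiniteMeasure_map _ _
  refine Measure.ext_of_Iic _ _ fun t => ?_
  rw [Measure.map_apply (measurable_rank hu) measurableSet_Iic]
  rcases lt_or_ge t 0 with h0 | h0
  · rw [unitMeasure_Iic (h0.le.trans zero_le_one), ENNReal.ofReal_of_nonpos h0.le]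
    convert measure_empty (μ := unitMeasure)
    ext x
    simp only [mem_preimage, mem_Iic, mem_empty_iff_false, iff_false, not_le]
    exact h0.trans_le measureReal_nonneg
  rcases le_or_gt 1 t with h1 | h1
  · have e1 : rank u ⁻¹' Iic t = univ := eq_univ_of_forall fun x => measureReal_le_one.trans h1
    have e2 : unitMeasure (Iic t) = 1 :=
      le_antisymm prob_le_one (by
        calc (1 : ℝ≥0∞) = unitMeasure (Iic 1) := by rw [unitMeasure_Iic le_rfl, ENNReal.ofReal_one]
          _ ≤ _ := measure_mono (Iic_subset_Iic.2 h1))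
    rw [e1, e2, measure_univ]
  rw [unitMeasure_Iic h1.le, ← ofReal_measureReal]
  congr 1
  refine le_antisymm (le_of_forall_gt_imp_ge_of_dense fun s hs => ?_) ?_
  · rcases le_or_gt s 1 with hs1 | hs1
    · obtain ⟨D, hD, hD1, -⟩ := exists_level_set hu (h0.trans hs.le) hs1
      rw [← hD]
      exact measureReal_mono fun x hx => hD1 (lt_of_le_of_lt hx hs)
    · exact measureReal_le_one.trans hs1.le
  · obtain ⟨D, hD, -, hD2⟩ := exists_level_set hu h0 h1.le
    exact hD.symm.le.trans (measureReal_mono hD2)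

namespace IsRINormENN

variable {N : (ℝ → ℝ≥0∞) → ℝ≥0∞}

/-- The associate norm of a function bounds that of its rearrangement. -/
lemma lintegral_mul_rearrENN_le (hN : IsRINormENN N) {g h : ℝ → ℝ≥0∞} {b K : ℝ≥0∞}
    (hg : AEMeasurable g unitMeasure) (hh : AEMeasurable h unitMeasure)
    (hK : ∀ w, AEMeasurable w unitMeasure → N w ≤ b → ∫⁻ t, w t * g t ∂unitMeasure ≤ K)
    (hb : N h ≤ b) : ∫⁻ t, h t * rearrENN g t ∂unitMeasure ≤ K := by
  have hσ := measurePreserving_rank hg.measurable_mk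
  set σ := rank (hg.mk g)
  have hm := hh.measurable_mk
  -- Composition with `σ` preserves the distribution function, hence the norm; `h` need not be
  -- monotone.
  have hNh : N (hh.mk h ∘ σ) = N h := by
    rw [hN.congr hh hh.ae_eq_mk]
    refine hN.rearr _ _ (hm.comp hσ.measurable).aemeasurable hm.aemeasurable fun l => ?_
    exact hσ.measure_preimage (measurableSet_lt measurable_const hm).nullMeasurableSet
  calc ∫⁻ t, h t * rearrENN g t ∂unitMeasure
      = ∫⁻ t, hh.mk h t * rearrENN (hg.mk g) t ∂unitMeasure := by
        rw [← rearrENN_congr hg.ae_eq_mk]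
        refine lintegral_congr_ae ?_
        filter_upwards [hh.ae_eq_mk] with t ht
        rw [← ht]
    _ = ∫⁻ t, hh.mk h (σ t) * rearrENN (hg.mk g) (σ t) ∂unitMeasure :=
        (hσ.lintegral_comp (hm.mul (measurable_rearrENN _))).symm
    _ ≤ ∫⁻ t, (hh.mk h ∘ σ) t * g t ∂unitMeasure := by
        refine lintegral_mono_ae ?_
        filter_upwards [hg.ae_eq_mk] with t ht
        rw [ht]
        exact mul_le_mul_right (rearrENN_rank_le _ t) _
    _ ≤ K := hK _ (hm.comp hσ.measurable).aemeasurable (hNh.trans_le hb)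

end IsRINormENN

/-! ### The Hardy–Littlewood inequality. -/

/-- The layer cake formula for functions with values in `[0,∞]`. -/
lemma lintegral_eq_lintegral_measure_lt (ν : Measure ℝ) [SFinite ν] {u : ℝ → ℝ≥0∞}
    (hu : AEMeasurable u ν) :
    ∫⁻ x, u x ∂ν = ∫⁻ l in Ioi (0 : ℝ), ν {x | ENNReal.ofReal l < u x} := by
  have hvol : ∀ c : ℝ≥0∞, volume (Ioi 0 ∩ {l : ℝ | ENNReal.ofReal l < c}) = c := fun c => by
    induction c with
    | top => simp
    | coe c =>
      have : Ioi 0 ∩ {l : ℝ | ENNReal.ofReal l < c} = Ioo 0 (c : ℝ) := by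
        ext l
        simp only [mem_inter_iff, mem_Ioi, mem_ofPred_eq, mem_Ioo]
        refine and_congr_right fun h => ?_
        rw [ENNReal.ofReal_lt_coe_iff h.le]
      rw [this, Real.volume_Ioo, sub_zero, ENNReal.ofReal_coe_nnreal]
  wlog hm : Measurable u generalizing u
  · rw [lintegral_congr_ae hu.ae_eq_mk, this hu.measurable_mk.aemeasurable hu.measurable_mk]
    refine lintegral_congr fun l => measure_congr (eventuallyEq_set.2 ?_)
    filter_upwards [hu.ae_eq_mk] with t ht
    simp only [ht]
  have hS : MeasurableSet {p : ℝ × ℝ | ENNReal.ofReal p.2 < u p.1} :=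
    measurableSet_lt (ENNReal.measurable_ofReal.comp measurable_snd) (hm.comp measurable_fst)
  have hl : ∀ x, MeasurableSet {l : ℝ | ENNReal.ofReal l < u x} := fun x =>
    measurableSet_lt ENNReal.measurable_ofReal measurable_const
  calc ∫⁻ x, u x ∂ν
      = ∫⁻ x, (∫⁻ l in Ioi (0 : ℝ), indicator {p : ℝ × ℝ | ENNReal.ofReal p.2 < u p.1} 1 (x, l)) ∂ν := by
        refine lintegral_congr fun x => ?_
        have : ∀ l, indicator {p : ℝ × ℝ | ENNReal.ofReal p.2 < u p.1} (1 : ℝ × ℝ → ℝ≥0∞) (x, l) =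
          indicator {l : ℝ | ENNReal.ofReal l < u x} 1 l := fun l => rfl
        simp only [this]
        rw [lintegral_indicator_one (hl x), Measure.restrict_apply (hl x), inter_comm, hvol]
    _ = ∫⁻ l in Ioi (0 : ℝ), (∫⁻ x, indicator {p : ℝ × ℝ | ENNReal.ofReal p.2 < u p.1} 1 (x, l) ∂ν) :=
        lintegral_lintegral_swap (measurable_one.indicator hS).aemeasurable
    _ = _ := by
        refine lintegral_congr fun l => ?_
        rw [← lintegral_indicator_one (measurableSet_lt measurable_const hm)]
        rfl

/-- The Hardy–Littlewood inequality for initial intervals. -/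
lemma lintegral_le_lintegral_rearrENN {u : ℝ → ℝ≥0∞} (hu : AEMeasurable u unitMeasure) {s : ℝ}
    (hs : s ≤ 1) : ∫⁻ t in Ioo 0 s, u t ≤ ∫⁻ t in Ioo 0 s, rearrENN u t := by
  have hle : (volume.restrict (Ioo 0 s) : Measure ℝ) ≤ unitMeasure :=
    Measure.restrict_mono (Ioo_subset_Ioo_right hs) le_rfl
  rw [lintegral_eq_lintegral_measure_lt _ (hu.mono_measure hle),
    lintegral_eq_lintegral_measure_lt _ (measurable_rearrENN u).aemeasurable]
  refine lintegral_mono fun l => ?_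
  have h1 : (volume.restrict (Ioo 0 s) : Measure ℝ) {x | ENNReal.ofReal l < u x} ≤
      min (ENNReal.ofReal s) (unitMeasure {x | ENNReal.ofReal l < u x}) :=
    le_min ((measure_mono (subset_univ _)).trans (by simp)) (hle _)
  refine h1.trans ?_
  set d := unitMeasure {x | ENNReal.ofReal l < u x} with hd
  -- The superlevel set of the rearrangement meets `(0,s)` in an interval of length at least `min s
  -- d`, so it attains the bound `h1`.
  have hset : {x | ENNReal.ofReal l < rearrENN u x} = {x | ENNReal.ofReal x < d} := by
    ext x
    exact lt_rearrENN_iff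
  rw [hset, Measure.restrict_apply (measurableSet_lt ENNReal.measurable_ofReal measurable_const)]
  have hsub : Ioo 0 (min s d.toReal) ⊆ {x | ENNReal.ofReal x < d} ∩ Ioo 0 s := fun x hx =>
    ⟨(ENNReal.ofReal_lt_iff_lt_toReal hx.1.le (measure_ne_top _ _)).2
      (hx.2.trans_le (min_le_right _ _)), hx.1, hx.2.trans_le (min_le_left _ _)⟩
  refine le_trans (le_of_eq ?_) (measure_mono hsub)
  rw [Real.volume_Ioo, sub_zero, ENNReal.ofReal_min, ENNReal.ofReal_toReal (measure_ne_top _ _)]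

/-! ### The Hardy operators and their adjointness. -/

/-- `t ↦ ∫_t^1 u w`. -/
noncomputable def hardyH (w u : ℝ → ℝ≥0∞) (t : ℝ) : ℝ≥0∞ := ∫⁻ s in Ioo t 1, u s * w s

/-- `t ↦ w(t) ∫_0^t u`. -/
noncomputable def hardyR (w u : ℝ → ℝ≥0∞) (t : ℝ) : ℝ≥0∞ := (∫⁻ s in Ioo 0 t, u s) * w t

/-- The properties of `w = 1 / J`. -/
structure IsWeight (w : ℝ → ℝ≥0∞) : Prop where
  aemeasurable : AEMeasurable w unitMeasure
  ne_zero : ∀ t ∈ Ioo (0 : ℝ) 1, w t ≠ 0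
  exists_le : ∃ c : ℝ≥0, ∀ t ∈ Ioo (0 : ℝ) 1, w t ≤ c / ENNReal.ofReal t

lemma restrict_Ioo_le {a b : ℝ} (ha : 0 ≤ a) (hb : b ≤ 1) :
    (volume.restrict (Ioo a b) : Measure ℝ) ≤ unitMeasure :=
  Measure.restrict_mono (Ioo_subset_Ioo ha hb) le_rfl

section Operators

variable {w u v : ℝ → ℝ≥0∞}

lemma antitone_hardyH (w u : ℝ → ℝ≥0∞) : Antitone (hardyH w u) := fun _ _ hst =>
  lintegral_mono_set (Ioo_subset_Ioo_left hst)

lemma antitone_hardyH_iterate (w u : ℝ → ℝ≥0∞) {j : ℕ} (hj : 1 ≤ j) :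
    Antitone ((hardyH w)^[j] u) := by
  obtain ⟨i, rfl⟩ := Nat.exists_eq_add_of_le' hj
  rw [Function.iterate_succ_apply']
  exact antitone_hardyH _ _

lemma aemeasurable_hardyH_iterate (w : ℝ → ℝ≥0∞) (hu : AEMeasurable u unitMeasure) (j : ℕ) :
    AEMeasurable ((hardyH w)^[j] u) unitMeasure := by
  rcases j.eq_zero_or_pos with rfl | hj
  · exact hu
  · exact (antitone_hardyH_iterate w u hj).measurable.aemeasurable

lemma aemeasurable_hardyR (hw : AEMeasurable w unitMeasure) (u : ℝ → ℝ≥0∞) :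
    AEMeasurable (hardyR w u) unitMeasure := by
  have : Monotone fun t => ∫⁻ s in Ioo 0 t, u s := fun _ _ hst =>
    lintegral_mono_set (Ioo_subset_Ioo_right hst)
  exact this.measurable.aemeasurable.mul hw

lemma aemeasurable_hardyR_iterate (hw : AEMeasurable w unitMeasure) (hu : AEMeasurable u unitMeasure)
    (j : ℕ) : AEMeasurable ((hardyR w)^[j] u) unitMeasure := by
  cases j with
  | zero => exact hu
  | succ j =>
    rw [Function.iterate_succ_apply']
    exact aemeasurable_hardyR hw _

lemma hardyH_mono (h : u ≤ᵐ[unitMeasure] v) {t : ℝ} (ht : 0 ≤ t) :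
    hardyH w u t ≤ hardyH w v t :=
  lintegral_mono_ae (by
    filter_upwards [ae_mono (restrict_Ioo_le ht le_rfl) h] with s hs using mul_le_mul_left hs _)

lemma hardyH_iterate_mono (h : u ≤ᵐ[unitMeasure] v) (j : ℕ) :
    (hardyH w)^[j] u ≤ᵐ[unitMeasure] (hardyH w)^[j] v := by
  induction j with
  | zero => exact h
  | succ j ih =>
    rw [Function.iterate_succ_apply', Function.iterate_succ_apply']
    filter_upwards [ae_mem_Ioo] with t ht using hardyH_mono ih ht.1.le

/-- The hypothesis compares primitives only: this is all that Hardy–Littlewood offers for `u` and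
`u*`, which are not comparable pointwise. -/
lemma hardyR_mono (h : ∀ s ≤ 1, ∫⁻ r in Ioo 0 s, u r ≤ ∫⁻ r in Ioo 0 s, v r) :
    hardyR w u ≤ᵐ[unitMeasure] hardyR w v := by
  filter_upwards [ae_mem_Ioo] with t ht using mul_le_mul_left (h t ht.2.le) _

lemma hardyR_iterate_mono (h : u ≤ᵐ[unitMeasure] v) (j : ℕ) :
    (hardyR w)^[j] u ≤ᵐ[unitMeasure] (hardyR w)^[j] v := by
  induction j with
  | zero => exact h
  | succ j ih =>
    rw [Function.iterate_succ_apply', Function.iterate_succ_apply']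
    exact hardyR_mono fun s hs => lintegral_mono_ae (ae_mono (restrict_Ioo_le le_rfl hs) ih)

/-- Passing to the rearrangement increases the iterated averages. -/
lemma hardyR_iterate_le_rearrENN (hu : AEMeasurable u unitMeasure) {j : ℕ} (hj : 1 ≤ j) :
    (hardyR w)^[j] u ≤ᵐ[unitMeasure] (hardyR w)^[j] (rearrENN u) := by
  obtain ⟨i, rfl⟩ := Nat.exists_eq_add_of_le' hj
  rw [Function.iterate_succ_apply, Function.iterate_succ_apply]
  exact hardyR_iterate_mono (hardyR_mono fun s hs => lintegral_le_lintegral_rearrENN hu hs) i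

/-- `hardyH` and `hardyR` are adjoint to each other. -/
lemma lintegral_hardyH_mul (hw : AEMeasurable w unitMeasure) (hu : AEMeasurable u unitMeasure)
    (hv : AEMeasurable v unitMeasure) :
    ∫⁻ t, hardyH w u t * v t ∂unitMeasure = ∫⁻ t, u t * hardyR w v t ∂unitMeasure := by
  have hS : MeasurableSet {p : ℝ × ℝ | p.1 < p.2} := measurableSet_lt measurable_fst measurable_snd
  have huw : AEMeasurable (fun t => u t * w t) unitMeasure := hu.mul hw
  let F : ℝ → ℝ → ℝ≥0∞ := fun t s =>
    indicator {p : ℝ × ℝ | p.1 < p.2} (fun p => u p.2 * w p.2 * v p.1) (t, s)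
  have hF : AEMeasurable (Function.uncurry F) (unitMeasure.prod unitMeasure) :=
    (huw.comp_snd.mul hv.comp_fst).indicator hS
  calc ∫⁻ t, hardyH w u t * v t ∂unitMeasure
      = ∫⁻ t, (∫⁻ s, F t s ∂unitMeasure) ∂unitMeasure := by
        refine lintegral_congr_ae ?_
        filter_upwards [ae_mem_Ioo] with t ht
        have h1 : (fun s => F t s) = indicator (Ioi t) fun s => u s * w s * v t := by
          ext s; rfl
        rw [h1, lintegral_indicator measurableSet_Ioi, unitMeasure,
          Measure.restrict_restrict measurableSet_Ioi, hardyH]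
        have h2 : Ioi t ∩ Ioo 0 1 = Ioo t 1 := by
          ext s
          simp only [mem_inter_iff, mem_Ioi, mem_Ioo]
          exact ⟨fun h => ⟨h.1, h.2.2⟩, fun h => ⟨h.1, ht.1.trans h.1, h.2⟩⟩
        rw [h2, lintegral_mul_const'' _ (huw.mono_measure (restrict_Ioo_le ht.1.le le_rfl))]
    _ = ∫⁻ s, (∫⁻ t, F t s ∂unitMeasure) ∂unitMeasure := lintegral_lintegral_swap hF
    _ = _ := by
        refine lintegral_congr_ae ?_
        filter_upwards [ae_mem_Ioo] with s hs
        have h1 : (fun t => F t s) = indicator (Iio s) fun t => u s * w s * v t := by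
          ext t; rfl
        rw [h1, lintegral_indicator measurableSet_Iio, unitMeasure,
          Measure.restrict_restrict measurableSet_Iio, hardyR]
        have h2 : Iio s ∩ Ioo 0 1 = Ioo 0 s := by
          ext t
          simp only [mem_inter_iff, mem_Iio, mem_Ioo]
          exact ⟨fun h => ⟨h.2.1, h.1⟩, fun h => ⟨h.2, h.1, h.2.trans hs.2⟩⟩
        rw [h2, lintegral_const_mul'' _ (hv.mono_measure (restrict_Ioo_le le_rfl hs.2.le))]
        ring

lemma lintegral_hardyH_iterate_mul (hw : AEMeasurable w unitMeasure)
    (hu : AEMeasurable u unitMeasure) (hv : AEMeasurable v unitMeasure) (j : ℕ) :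
    ∫⁻ t, (hardyH w)^[j] u t * v t ∂unitMeasure =
      ∫⁻ t, u t * (hardyR w)^[j] v t ∂unitMeasure := by
  induction j generalizing u with
  | zero => rfl
  | succ j ih =>
    rw [Function.iterate_succ_apply, ih (antitone_hardyH w u).measurable.aemeasurable,
      lintegral_hardyH_mul hw hu (aemeasurable_hardyR_iterate hw hv j),
      Function.iterate_succ_apply']

lemma hardyH_add_le (hw : AEMeasurable w unitMeasure) (hu : AEMeasurable u unitMeasure)
    {x : ℝ → ℝ≥0∞} (h : x ≤ᵐ[unitMeasure] fun t => u t + v t) {t : ℝ} (ht : 0 ≤ t) :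
    hardyH w x t ≤ hardyH w u t + hardyH w v t := by
  refine (hardyH_mono h ht).trans_eq ?_
  have : AEMeasurable (fun t => u t * w t) (volume.restrict (Ioo t 1)) :=
    (hu.mul hw).mono_measure (restrict_Ioo_le ht le_rfl)
  rw [hardyH, hardyH, hardyH, ← lintegral_add_left' this]
  simp only [add_mul]

lemma hardyH_iterate_add_le (hw : AEMeasurable w unitMeasure) (hu : AEMeasurable u unitMeasure)
    {x : ℝ → ℝ≥0∞} (h : x ≤ᵐ[unitMeasure] fun t => u t + v t) (j : ℕ) :
    (hardyH w)^[j] x ≤ᵐ[unitMeasure] fun t => (hardyH w)^[j] u t + (hardyH w)^[j] v t := by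
  induction j with
  | zero => exact h
  | succ j ih =>
    simp only [Function.iterate_succ_apply']
    filter_upwards [ae_mem_Ioo] with t ht using
      hardyH_add_le hw (aemeasurable_hardyH_iterate w hu j) ih ht.1.le

lemma hardyH_const_mul {c : ℝ≥0∞} (hc : c ≠ ∞) (u : ℝ → ℝ≥0∞) :
    hardyH w (fun t => c * u t) = fun t => c * hardyH w u t := by
  ext t
  simp only [hardyH, mul_assoc]
  exact lintegral_const_mul' _ _ hc

lemma hardyH_iterate_const_mul {c : ℝ≥0∞} (hc : c ≠ ∞) (u : ℝ → ℝ≥0∞) (j : ℕ) :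
    (hardyH w)^[j] (fun t => c * u t) = fun t => c * (hardyH w)^[j] u t := by
  induction j with
  | zero => rfl
  | succ j ih => rw [Function.iterate_succ_apply', ih, hardyH_const_mul hc,
      Function.iterate_succ_apply']

lemma weight_le {c : ℝ≥0} (hc : ∀ t ∈ Ioo (0 : ℝ) 1, w t ≤ c / ENNReal.ofReal t) {s t : ℝ}
    (ht : 0 < t) (hts : t < s) (hs : s < 1) : w s ≤ c / ENNReal.ofReal t :=
  (hc s ⟨ht.trans hts, hs⟩).trans
    (ENNReal.div_le_div_left (ENNReal.ofReal_le_ofReal hts.le) _)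

/-- For `s > t` both the weight bound `c / s` and the previous estimate are at most their values at
`t`, and `(t,1)` has length at most 1, so each further integration costs one factor `c / t`. -/
lemma hardyH_iterate_le {c : ℝ≥0} (hc : ∀ t ∈ Ioo (0 : ℝ) 1, w t ≤ c / ENNReal.ofReal t)
    (u : ℝ → ℝ≥0∞) (j : ℕ) {t : ℝ} (ht : t ∈ Ioo (0 : ℝ) 1) :
    (hardyH w)^[j + 1] u t ≤ (c / ENNReal.ofReal t) ^ (j + 1) * ∫⁻ s, u s ∂unitMeasure := by
  have htop : (c / ENNReal.ofReal t) ≠ ∞ :=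
    ENNReal.div_ne_top ENNReal.coe_ne_top (by simpa using ht.1)
  induction j generalizing t with
  | zero =>
    simp only [zero_add, Function.iterate_one, pow_one]
    calc hardyH w u t ≤ ∫⁻ s in Ioo t 1, c / ENNReal.ofReal t * u s :=
          setLIntegral_mono_ae' measurableSet_Ioo (.of_forall fun s hs => by
            rw [mul_comm]
            exact mul_le_mul_left (weight_le hc ht.1 hs.1 hs.2) _)
      _ = c / ENNReal.ofReal t * ∫⁻ s in Ioo t 1, u s := lintegral_const_mul' _ _ htop
      _ ≤ _ := mul_le_mul_right (lintegral_mono' (restrict_Ioo_le ht.1.le le_rfl) le_rfl) _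
  | succ j ih =>
    rw [Function.iterate_succ_apply']
    calc hardyH w ((hardyH w)^[j + 1] u) t
        ≤ ∫⁻ _ in Ioo t 1, (c / ENNReal.ofReal t) ^ (j + 1) * (∫⁻ s, u s ∂unitMeasure) *
            (c / ENNReal.ofReal t) :=
          setLIntegral_mono_ae' measurableSet_Ioo (.of_forall fun s hs => by
            have hs0 := ht.1.trans hs.1
            refine mul_le_mul' ((ih ⟨hs0, hs.2⟩ (ENNReal.div_ne_top ENNReal.coe_ne_top
              (by simpa using hs0))).trans ?_) (weight_le hc ht.1 hs.1 hs.2)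
            gcongr
            exact hs.1.le)
      _ ≤ (c / ENNReal.ofReal t) ^ (j + 1) * (∫⁻ s, u s ∂unitMeasure) *
            (c / ENNReal.ofReal t) := by
          rw [lintegral_const]
          refine mul_le_of_le_one_right' ?_
          simpa using ht.1.le
      _ = _ := by ring

lemma hardyH_iterate_eq_zero {b : ℝ} (h : ∀ t, b ≤ t → u t = 0) (j : ℕ) {t : ℝ} (ht : b ≤ t) :
    (hardyH w)^[j] u t = 0 := by
  induction j generalizing t with
  | zero => exact h t ht
  | succ j ih =>
    rw [Function.iterate_succ_apply']
    refine (setLIntegral_congr_fun measurableSet_Ioo (g := 0) fun s hs => ?_).trans lintegral_zero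
    simp [ih (ht.trans hs.1.le)]

lemma hardyH_ne_zero (hw : IsWeight w) (hu : AEMeasurable u unitMeasure)
    (h : ∀ t ∈ Ioo (0 : ℝ) 1, u t ≠ 0) {t : ℝ} (ht : t ∈ Ioo (0 : ℝ) 1) :
    hardyH w u t ≠ 0 := by
  intro h0
  have hm := (hu.mul hw.aemeasurable).mono_measure (restrict_Ioo_le ht.1.le le_rfl)
  have h1 := (lintegral_eq_zero_iff' hm).1 h0
  have h2 : ∀ᵐ s ∂volume.restrict (Ioo t 1), False := by
    filter_upwards [h1, ae_restrict_mem measurableSet_Ioo] with s hs hst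
    have hs' : s ∈ Ioo (0 : ℝ) 1 := ⟨ht.1.trans hst.1, hst.2⟩
    exact mul_ne_zero (h s hs') (hw.ne_zero s hs') hs
  have h3 : volume.restrict (Ioo t 1) = 0 := ae_eq_bot.1 (eventually_false_iff_eq_bot.1 h2)
  have h4 := Measure.restrict_eq_zero.1 h3
  rw [Real.volume_Ioo, ENNReal.ofReal_eq_zero] at h4
  linarith [ht.2]

lemma hardyH_iterate_ne_zero (hw : IsWeight w) (hu : AEMeasurable u unitMeasure)
    (h : ∀ t ∈ Ioo (0 : ℝ) 1, u t ≠ 0) (j : ℕ) {t : ℝ} (ht : t ∈ Ioo (0 : ℝ) 1) :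
    (hardyH w)^[j] u t ≠ 0 := by
  induction j generalizing t with
  | zero => exact h t ht
  | succ j ih =>
    rw [Function.iterate_succ_apply']
    exact hardyH_ne_zero hw (aemeasurable_hardyH_iterate w hu j) (fun t ht => ih ht) ht

/-- Functions supported away from the origin are mapped to bounded ones. -/
lemma hardyH_le_of_support {c : ℝ≥0} (hc : ∀ t ∈ Ioo (0 : ℝ) 1, w t ≤ c / ENNReal.ofReal t)
    {b : ℝ} (hb : 0 < b) (h : ∀ t < b, u t = 0) {t : ℝ} (ht : 0 ≤ t) :
    hardyH w u t ≤ c / ENNReal.ofReal b * ∫⁻ s, u s ∂unitMeasure := by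
  have htop : (c / ENNReal.ofReal b) ≠ ∞ :=
    ENNReal.div_ne_top ENNReal.coe_ne_top (by simpa using hb)
  rw [← lintegral_const_mul' _ _ htop]
  refine (setLIntegral_mono_ae' measurableSet_Ioo (.of_forall fun s hs => ?_)).trans
    (lintegral_mono' (restrict_Ioo_le ht le_rfl) le_rfl)
  rcases lt_or_ge s b with hsb | hsb
  · simp [h s hsb]
  · rw [mul_comm]
    refine mul_le_mul_left ((hc s ⟨hb.trans_le hsb, hs.2⟩).trans ?_) _
    exact ENNReal.div_le_div_left (ENNReal.ofReal_le_ofReal hsb) _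

lemma hardyH_le_add (a t : ℝ) (u : ℝ → ℝ≥0∞) :
    hardyH w u t ≤ (∫⁻ s in Ioo t a, u s * w s) + hardyH w u a := by
  have h : Ioo t 1 ⊆ Ioo t a ∪ ({a} ∪ Ioo a 1) := fun s hs => by
    rcases lt_trichotomy s a with h | h | h
    · exact Or.inl ⟨hs.1, h⟩
    · exact Or.inr (Or.inl h)
    · exact Or.inr (Or.inr ⟨h, hs.2⟩)
  refine (lintegral_mono_set h).trans ((lintegral_union_le _ _ _).trans ?_)
  refine add_le_add le_rfl ((lintegral_union_le _ _ _).trans_eq ?_)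
  rw [setLIntegral_measure_zero _ _ (by simp), zero_add]
  rfl

end Operators

/-! ### Growth of the iterates of 1 for a nonintegrable weight. -/

section Divergence

variable {w : ℝ → ℝ≥0∞}

lemma tendsto_hardyH_one (hdiv : ∫⁻ s, w s ∂unitMeasure = ∞) :
    Tendsto (hardyH w fun _ => 1) (𝓝[>] 0) (𝓝 ∞) := by
  obtain ⟨r, hr, hrl, hrt⟩ := exists_seq_strictAnti_tendsto' (zero_lt_one' ℝ)
  rw [ENNReal.tendsto_nhds_top_iff_nat]
  intro K
  have hmon : Monotone fun n => Ioo (r n) 1 := fun m n hmn =>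
    Ioo_subset_Ioo_left (hr.antitone hmn)
  have hU : ⋃ n, Ioo (r n) 1 = Ioo 0 1 := by
    ext s
    simp only [mem_iUnion, mem_Ioo, exists_and_right]
    refine ⟨fun ⟨⟨n, hn⟩, h⟩ => ⟨(hrl n).1.trans hn, h⟩, fun h => ⟨?_, h.2⟩⟩
    exact (hrt.eventually (gt_mem_nhds h.1)).exists
  have h2 : ⨆ n, hardyH w (fun _ => 1) (r n) = ∞ := by
    rw [← hdiv, unitMeasure, ← hU, setLIntegral_iUnion_of_directed _ hmon.directed_le]
    simp only [hardyH, one_mul]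
  obtain ⟨n, hn⟩ := lt_iSup_iff.1 (h2 ▸ ENNReal.natCast_lt_top K)
  filter_upwards [Ioo_mem_nhdsGT (hrl n).1] with t ht
  exact hn.trans_le (antitone_hardyH w _ ht.2.le)

/-- If `u` is negligible with respect to `v` at the origin and `∫_t^1 v w` diverges, then
`∫_t^1 u w` is negligible with respect to `∫_t^1 v w`. -/
lemma hardyH_le_mul_hardyH {u v : ℝ → ℝ≥0∞}
    (hu : ∀ a ∈ Ioo (0 : ℝ) 1, hardyH w u a ≠ ∞)
    (huv : ∀ ε : ℝ≥0, 0 < ε → ∀ᶠ t in 𝓝[>] 0, u t ≤ ε * v t)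
    (hv : Tendsto (hardyH w v) (𝓝[>] 0) (𝓝 ∞)) (ε : ℝ≥0) (hε : 0 < ε) :
    ∀ᶠ t in 𝓝[>] 0, hardyH w u t ≤ ε * hardyH w v t := by
  have hε2 : 0 < ε / 2 := by positivity
  obtain ⟨b, hb0, hb⟩ := mem_nhdsGT_iff_exists_Ioo_subset.1 (huv _ hε2)
  obtain ⟨a, ha0, hab⟩ := exists_between (lt_min (mem_Ioi.1 hb0) one_pos)
  have ha : a ∈ Ioo (0 : ℝ) 1 := ⟨ha0, hab.trans_le (min_le_right _ _)⟩
  -- On `(t,a)` the integrand is at most `ε/2` times that of `v`; the fixed finite integral over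
  -- `(a,1)` is absorbed by the other `ε/2`, thanks to divergence.
  have hne : hardyH w u a / (ε / 2 : ℝ≥0) ≠ ∞ :=
    ENNReal.div_ne_top (hu a ha) (by exact_mod_cast hε2.ne')
  filter_upwards [hv.eventually (lt_mem_nhds hne.lt_top), Ioo_mem_nhdsGT ha0] with t ht hta
  calc hardyH w u t ≤ (∫⁻ s in Ioo t a, u s * w s) + hardyH w u a :=
        hardyH_le_add a t u
    _ ≤ (ε / 2 : ℝ≥0) * hardyH w v t + (ε / 2 : ℝ≥0) * hardyH w v t := by
        gcongr
        · calc ∫⁻ s in Ioo t a, u s * w s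
              ≤ ∫⁻ s in Ioo t a, (ε / 2 : ℝ≥0) * (v s * w s) :=
                setLIntegral_mono_ae' measurableSet_Ioo (.of_forall fun s hs => by
                  rw [← mul_assoc]
                  exact mul_le_mul_left (hb ⟨hta.1.trans hs.1,
                    hs.2.trans (hab.trans_le (min_le_left _ _))⟩) _)
            _ = (ε / 2 : ℝ≥0) * ∫⁻ s in Ioo t a, v s * w s :=
                lintegral_const_mul' _ _ ENNReal.coe_ne_top
            _ ≤ _ := mul_le_mul_right (lintegral_mono_set (Ioo_subset_Ioo_right ha.2.le)) _
        · rw [mul_comm]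
          exact (ENNReal.div_le_iff (by exact_mod_cast hε2.ne') ENNReal.coe_ne_top).1 ht.le
    _ = ε * hardyH w v t := by
        rw [← add_mul, ← ENNReal.coe_add, add_halves]

/-- Near 0 one has `v > 1`, so up to the finite amount `∫_a^1 w` the integral dominates the
divergent one for the constant 1. -/
lemma tendsto_hardyH_of_tendsto (hw : IsWeight w) (hdiv : ∫⁻ s, w s ∂unitMeasure = ∞)
    {v : ℝ → ℝ≥0∞} (hv : Tendsto v (𝓝[>] 0) (𝓝 ∞)) :
    Tendsto (hardyH w v) (𝓝[>] 0) (𝓝 ∞) := by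
  have h1 := tendsto_hardyH_one hdiv
  have hone : ∀ a ∈ Ioo (0 : ℝ) 1, hardyH w (fun _ => 1) a ≠ ∞ := fun a ha => by
    obtain ⟨c, hc⟩ := hw.exists_le
    refine ne_top_of_le_ne_top ?_ (hardyH_iterate_le hc (fun _ => 1) 0 ha)
    simp only [lintegral_const, measure_univ, mul_one, zero_add, pow_one]
    exact ENNReal.div_ne_top ENNReal.coe_ne_top (by simpa using ha.1)
  obtain ⟨b, hb0, hb⟩ := mem_nhdsGT_iff_exists_Ioo_subset.1
    (hv.eventually (lt_mem_nhds ENNReal.one_lt_top))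
  obtain ⟨a, ha0, hab⟩ := exists_between (lt_min (mem_Ioi.1 hb0) one_pos)
  have ha : a ∈ Ioo (0 : ℝ) 1 := ⟨ha0, hab.trans_le (min_le_right _ _)⟩
  rw [ENNReal.tendsto_nhds_top_iff_nnreal]
  intro K
  have hne : K + hardyH w (fun _ => 1) a ≠ ∞ := ENNReal.add_ne_top.2 ⟨ENNReal.coe_ne_top, hone a ha⟩
  filter_upwards [h1.eventually (lt_mem_nhds hne.lt_top), Ioo_mem_nhdsGT ha0] with t ht hta
  have h2 : (∫⁻ s in Ioo t a, 1 * w s) ≤ hardyH w v t :=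
    (setLIntegral_mono_ae' measurableSet_Ioo (.of_forall fun s hs =>
      mul_le_mul_left (hb ⟨hta.1.trans hs.1, hs.2.trans (hab.trans_le (min_le_left _ _))⟩).le _)).trans
      (lintegral_mono_set (Ioo_subset_Ioo_right ha.2.le))
  exact (ENNReal.add_lt_add_iff_right (hone a ha)).1
    (ht.trans_le ((hardyH_le_add a t _).trans (add_le_add h2 le_rfl)))

lemma hardyH_iterate_ne_top (hw : IsWeight w) {u : ℝ → ℝ≥0∞}
    (hu : ∫⁻ s, u s ∂unitMeasure ≠ ∞) (j : ℕ) {t : ℝ} (ht : t ∈ Ioo (0 : ℝ) 1) :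
    (hardyH w)^[j + 1] u t ≠ ∞ := by
  obtain ⟨c, hc⟩ := hw.exists_le
  refine ne_top_of_le_ne_top ?_ (hardyH_iterate_le hc u j ht)
  exact ENNReal.mul_ne_top (ENNReal.pow_ne_top
    (ENNReal.div_ne_top ENNReal.coe_ne_top (by simpa using ht.1))) hu

/-- If `w` is not integrable, then each iterate of `1` is negligible with respect to the next one
at the origin. -/
lemma hardyH_iterate_one_le (hw : IsWeight w) (hdiv : ∫⁻ s, w s ∂unitMeasure = ∞) (j : ℕ) :
    Tendsto ((hardyH w)^[j + 1] fun _ => 1) (𝓝[>] 0) (𝓝 ∞) ∧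
    ∀ ε : ℝ≥0, 0 < ε → ∀ᶠ t in 𝓝[>] 0,
      (hardyH w)^[j] (fun _ => 1) t ≤ ε * (hardyH w)^[j + 1] (fun _ => 1) t := by
  induction j with
  | zero =>
    refine ⟨tendsto_hardyH_one hdiv, fun ε hε => ?_⟩
    have hne : (1 : ℝ≥0∞) / ε ≠ ∞ := ENNReal.div_ne_top ENNReal.one_ne_top (by exact_mod_cast hε.ne')
    filter_upwards [(tendsto_hardyH_one hdiv).eventually (lt_mem_nhds hne.lt_top)] with t ht
    rw [mul_comm]
    exact (ENNReal.div_le_iff (by exact_mod_cast hε.ne') ENNReal.coe_ne_top).1 ht.le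
  | succ j ih =>
    have h := tendsto_hardyH_of_tendsto hw hdiv ih.1
    rw [← Function.iterate_succ_apply' (hardyH w)] at h
    refine ⟨h, fun ε hε => ?_⟩
    have h2 := hardyH_le_mul_hardyH (w := w) (fun a ha => by
      rw [← Function.iterate_succ_apply' (hardyH w)]
      exact hardyH_iterate_ne_top hw (by simp) j ha) ih.2
      (by rwa [← Function.iterate_succ_apply' (hardyH w)]) ε hε
    simpa only [← Function.iterate_succ_apply' (hardyH w)] using h2

end Divergence

/-! ### The optimal range norm and duality. -/

/-- The closed unit ball of `N`. -/
def unitBallENN (N : (ℝ → ℝ≥0∞) → ℝ≥0∞) : Set (ℝ → ℝ≥0∞) :=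
  {u | AEMeasurable u unitMeasure ∧ N u ≤ 1}

/-- The associate norm on functions with values in `[0,∞]`. -/
noncomputable def dualENN (N : (ℝ → ℝ≥0∞) → ℝ≥0∞) (v : ℝ → ℝ≥0∞) : ℝ≥0∞ :=
  ⨆ u ∈ unitBallENN N, ∫⁻ t, v t * u t ∂unitMeasure

lemma lintegral_le_dualENN {N : (ℝ → ℝ≥0∞) → ℝ≥0∞} {u : ℝ → ℝ≥0∞} (hu : u ∈ unitBallENN N)
    (v : ℝ → ℝ≥0∞) : ∫⁻ t, v t * u t ∂unitMeasure ≤ dualENN N v :=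
  le_iSup₂ (f := fun u (_ : u ∈ unitBallENN N) => ∫⁻ t, v t * u t ∂unitMeasure) u hu

/-- The optimal range norm on functions with values in `[0,∞]`. -/
noncomputable def rangeENN (w : ℝ → ℝ≥0∞) (j : ℕ) (N : (ℝ → ℝ≥0∞) → ℝ≥0∞) :
    (ℝ → ℝ≥0∞) → ℝ≥0∞ :=
  dualENN fun v => dualENN N ((hardyR w)^[j] (rearrENN v))

/-- The fundamental function of `M`. -/
noncomputable def fundamental (M : (ℝ → ℝ≥0∞) → ℝ≥0∞) (a : ℝ) : ℝ≥0∞ :=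
  M ((Ioo 0 a).indicator 1)

section Range

variable {w : ℝ → ℝ≥0∞} {M N : (ℝ → ℝ≥0∞) → ℝ≥0∞} {j : ℕ}

/-- By adjointness the pairing of `H^j u` with `v` is that of `u` with `R^j v`, and `R^j v ≤ R^j
v*`. -/
lemma hardyH_iterate_mem_unitBallENN (hw : IsWeight w) (hj : 1 ≤ j) {u : ℝ → ℝ≥0∞}
    (hu : u ∈ unitBallENN N) : (hardyH w)^[j] u ∈ unitBallENN (rangeENN w j N) := by
  refine ⟨aemeasurable_hardyH_iterate w hu.1 j, iSup₂_le fun v hv => ?_⟩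
  rw [lintegral_hardyH_iterate_mul hw.aemeasurable hu.1 hv.1]
  refine (lintegral_mono_ae ?_).trans ((lintegral_le_dualENN hu _).trans hv.2)
  filter_upwards [hardyR_iterate_le_rearrENN hv.1 hj] with t ht
  rw [mul_comm]
  exact mul_le_mul_left ht _

/-- Below `a` this is monotonicity; from `a` on, level 0 is admissible because the support has
measure at most `a`. -/
lemma rearrENN_indicator_le {E : Set ℝ} {a : ℝ} (hE : unitMeasure E ≤ ENNReal.ofReal a)
    (g : ℝ → ℝ≥0∞) {t : ℝ} (ht : 0 < t) :
    rearrENN (E.indicator g) t ≤ (Ioo 0 a).indicator (rearrENN g) t := by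
  by_cases hta : t < a
  · rw [indicator_of_mem (show t ∈ Ioo 0 a from ⟨ht, hta⟩)]
    refine le_iInf₂ fun l hl => iInf₂_le l ((measure_mono fun x hx => ?_).trans hl)
    exact lt_of_lt_of_le (mem_ofPred_eq ▸ hx : _ < _) (indicator_le_self _ _ _)
  · refine (iInf₂_le 0 ?_).trans (zero_le)
    refine (measure_mono fun x hx => ?_).trans
      (hE.trans (ENNReal.ofReal_le_ofReal (not_lt.1 hta)))
    by_contra hxE
    simp [hxE] at hx

/-- The passage from tails on `(0,a)` to arbitrary sets of measure at most `a`. After division by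
`c` it suffices, by Lorentz–Luxemburg, to test against `g` in the dual ball of `M`; the point is
that `χ_E g / c` lies in the ball whose associate defines the range norm. -/
lemma IsRINormENN.indicator_le_of_rangeENN (hM : IsRINormENN M) (hw : IsWeight w) {a : ℝ}
    {c : ℝ≥0} (hc : c ≠ 0)
    (hS : ∀ u ∈ unitBallENN N, M ((Ioo 0 a).indicator ((hardyH w)^[j] u)) ≤ c)
    {E : Set ℝ} (hEm : NullMeasurableSet E unitMeasure) (hE : unitMeasure E ≤ ENNReal.ofReal a)
    {f : ℝ → ℝ≥0∞} (hf : f ∈ unitBallENN (rangeENN w j N)) : M (E.indicator f) ≤ c := by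
  have hc' : (c : ℝ≥0∞) ≠ 0 := by exact_mod_cast hc
  have hinv : (c⁻¹ : ℝ≥0∞) = (c⁻¹ : ℝ≥0) := (ENNReal.coe_inv hc).symm
  have hfE : AEMeasurable (E.indicator f) unitMeasure := hf.1.indicator₀ hEm
  have hscale : ∀ u, AEMeasurable u unitMeasure →
      (M (fun t => (c⁻¹ : ℝ≥0) * u t) ≤ 1 ↔ M u ≤ c) := fun u hu => by
    rw [hM.smul _ hu, ← hinv, mul_comm, ← div_eq_mul_inv,
      ENNReal.div_le_iff hc' ENNReal.coe_ne_top, one_mul]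
  rw [← hscale _ hfE]
  refine hM.le_one_of_forall_dual (hfE.const_mul _) fun g hg hg1 => ?_
  have hcg : AEMeasurable (fun t => (c⁻¹ : ℝ≥0) * g t) unitMeasure := hg.const_mul _
  set g₁ : ℝ → ℝ≥0∞ := fun t => (c⁻¹ : ℝ≥0) * g t
  have hball : E.indicator g₁ ∈ unitBallENN fun v => dualENN N ((hardyR w)^[j] (rearrENN v)) := by
    refine ⟨hcg.indicator₀ hEm, iSup₂_le fun u hu => ?_⟩
    calc ∫⁻ t, (hardyR w)^[j] (rearrENN (E.indicator g₁)) t * u t ∂unitMeasure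
        = ∫⁻ t, (hardyH w)^[j] u t * rearrENN (E.indicator g₁) t ∂unitMeasure := by
          rw [lintegral_hardyH_iterate_mul hw.aemeasurable hu.1
            (measurable_rearrENN _).aemeasurable]
          simp only [mul_comm]
      _ ≤ ∫⁻ t, (Ioo 0 a).indicator ((hardyH w)^[j] u) t * rearrENN g₁ t ∂unitMeasure := by
          refine lintegral_mono_ae ?_
          filter_upwards [ae_mem_Ioo] with t ht
          refine (mul_le_mul_right (rearrENN_indicator_le hE g₁ ht.1) _).trans_eq ?_
          by_cases hta : t ∈ Ioo 0 a <;> simp [hta]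
      _ ≤ 1 := by
          -- The tail has norm at most `c`, and `g₁ = g / c` pairs to at most 1 with every function
          -- of norm at most `c`; this persists for its rearrangement.
          refine hM.lintegral_mul_rearrENN_le hcg
            ((aemeasurable_hardyH_iterate w hu.1 j).indicator measurableSet_Ioo)
            (fun v hv hvc => ?_) (hS u hu)
          refine le_trans (le_of_eq ?_) (hg1 _ (hv.const_mul _) ((hscale v hv).2 hvc))
          exact lintegral_congr fun t => by ring
  refine le_trans (le_of_eq ?_) ((lintegral_le_dualENN hball f).trans hf.2)
  refine lintegral_congr fun t => ?_
  by_cases ht : t ∈ E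
  · simp only [ht, indicator_of_mem, g₁]
    ring
  · simp [ht]

end Range

/-! ### The fundamental function near the origin. -/

section Fundamental

variable {M : (ℝ → ℝ≥0∞) → ℝ≥0∞}

lemma IsRINormENN.indicator_mono (hM : IsRINormENN M) {E F : Set ℝ} {u : ℝ → ℝ≥0∞}
    (hu : AEMeasurable u unitMeasure) (hE : MeasurableSet E) (hF : MeasurableSet F) (h : E ⊆ F) :
    M (E.indicator u) ≤ M (F.indicator u) :=
  hM.mono _ _ (hu.indicator hE) (hu.indicator hF)
    (.of_forall fun _ => indicator_le_indicator_of_subset h (fun _ => zero_le) _)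

lemma IsRINormENN.fundamental_mono (hM : IsRINormENN M) : Monotone (fundamental M) :=
  fun _ _ hab => hM.indicator_mono aemeasurable_const measurableSet_Ioo measurableSet_Ioo
    (Ioo_subset_Ioo_right hab)

lemma unitMeasure_Ioo {r : ℝ} (hr : r ≤ 1) : unitMeasure (Ioo 0 r) = ENNReal.ofReal r := by
  rw [unitMeasure, Measure.restrict_apply measurableSet_Ioo,
    inter_eq_left.2 (Ioo_subset_Ioo_right hr), Real.volume_Ioo, sub_zero]

lemma IsRINormENN.indicator_one_eq (hM : IsRINormENN M) {E : Set ℝ}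
    (hE : NullMeasurableSet E unitMeasure) :
    M (E.indicator 1) = fundamental M (unitMeasure.real E) := by
  refine hM.rearr _ _ (aemeasurable_one.indicator₀ hE)
    (aemeasurable_one.indicator measurableSet_Ioo) fun l => ?_
  have h : ∀ s : Set ℝ, {x | (l : ℝ≥0∞) < s.indicator 1 x} = if l < 1 then s else ∅ := fun s => by
    ext x
    split_ifs with hl <;> by_cases hx : x ∈ s <;> simp [hx] <;> simpa using hl
  rw [h, h]
  split_ifs
  · rw [unitMeasure_Ioo measureReal_le_one, ofReal_measureReal]
  · rfl

/-- The fundamental function vanishes at the origin unless all functions of finite norm are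
bounded. -/
lemma IsRINormENN.tendsto_fundamental (hM : IsRINormENN M) {f : ℝ → ℝ≥0∞}
    (hf : AEMeasurable f unitMeasure) (hfM : M f < ∞) (hf_top : essSup f unitMeasure = ∞) :
    Tendsto (fundamental M) (𝓝[>] 0) (𝓝 0) := by
  rw [ENNReal.tendsto_nhds_zero]
  intro ε hε
  by_contra hcon
  -- By monotonicity, failure of the limit bounds the fundamental function below by `ε`. Since each
  -- `{f > n}` has positive measure, `n ε ≤ M f` for all `n`.
  have hlow : ∀ a, 0 < a → ε ≤ fundamental M a := fun a ha => by
    by_contra! hlt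
    refine hcon ?_
    filter_upwards [Ioo_mem_nhdsGT ha] with t ht using (hM.fundamental_mono ht.2.le).trans hlt.le
  have hE : ∀ n : ℕ, NullMeasurableSet {x | (n : ℝ≥0∞) < f x} unitMeasure := fun n =>
    nullMeasurableSet_lt aemeasurable_const hf
  have hpos : ∀ n : ℕ, 0 < unitMeasure.real {x | (n : ℝ≥0∞) < f x} := fun n => by
    rw [measureReal_def, ENNReal.toReal_pos_iff]
    refine ⟨pos_iff_ne_zero.2 fun h0 => ?_, measure_lt_top _ _⟩
    have : essSup f unitMeasure ≤ n := essSup_le_of_ae_le _ (by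
      rw [Filter.EventuallyLE, ae_iff]
      simpa using h0)
    rw [hf_top] at this
    exact absurd this (by simp)
  have hge : ∀ n : ℕ, (n : ℝ≥0∞) * ε ≤ M f := fun n => by
    have h1 : AEMeasurable ({x | (n : ℝ≥0∞) < f x}.indicator (1 : ℝ → ℝ≥0∞)) unitMeasure :=
      aemeasurable_one.indicator₀ (hE n)
    calc (n : ℝ≥0∞) * ε ≤ ((n : ℝ≥0) : ℝ≥0∞) * M ({x | (n : ℝ≥0∞) < f x}.indicator 1) := by
          rw [hM.indicator_one_eq (hE n)]
          exact mul_le_mul' (by simp) (hlow _ (hpos n))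
      _ = M (fun t => ((n : ℝ≥0) : ℝ≥0∞) * {x | (n : ℝ≥0∞) < f x}.indicator 1 t) :=
          (hM.smul _ h1 _).symm
      _ ≤ M f := hM.mono _ _ (h1.const_mul _) hf (.of_forall fun t => by
          by_cases ht : (n : ℝ≥0∞) < f t
          · simpa [ht] using ht.le
          · simp [ht])
  have htop : (⨆ n : ℕ, (n : ℝ≥0∞)) * ε ≤ M f := by
    rw [ENNReal.iSup_mul]
    exact iSup_le hge
  rw [ENNReal.iSup_natCast, ENNReal.top_mul hε.ne'] at htop
  exact hfM.not_ge htop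

end Fundamental

section Tail

variable {w : ℝ → ℝ≥0∞} {M N : (ℝ → ℝ≥0∞) → ℝ≥0∞}

lemma exists_const_mem_unitBallENN (hN : IsRINormENN N) :
    ∃ κ : ℝ≥0, κ ≠ 0 ∧ (fun _ => (κ : ℝ≥0∞)) ∈ unitBallENN N := by
  have h1 := hN.one_lt_top
  set m := (N fun _ => 1).toNNReal
  have hm : N (fun _ => 1) = m := (ENNReal.coe_toNNReal h1.ne).symm
  refine ⟨(m + 1)⁻¹, by positivity, aemeasurable_const, ?_⟩
  have := hN.smul (fun _ => 1) aemeasurable_const (m + 1)⁻¹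
  simp only [mul_one] at this
  rw [this, hm, ← ENNReal.coe_mul, ← ENNReal.coe_one, ENNReal.coe_le_coe, mul_comm,
    ← div_eq_mul_inv]
  exact div_le_one_of_le₀ (by simp) (by positivity)

/-- If the tails of the images of the unit ball are uniformly small, then the fundamental function
vanishes at the origin. -/
lemma IsRINormENN.tendsto_fundamental_of_tail (hM : IsRINormENN M) (hN : IsRINormENN N)
    (hw : IsWeight w) {j : ℕ} (hj : 1 ≤ j)
    (h : ∀ ε : ℝ≥0, 0 < ε → ∃ a ∈ Ioo (0 : ℝ) 1, ∀ u ∈ unitBallENN N,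
      M ((Ioo 0 a).indicator ((hardyH w)^[j] u)) ≤ ε) :
    Tendsto (fundamental M) (𝓝[>] 0) (𝓝 0) := by
  obtain ⟨κ, hκ, hκN⟩ := exists_const_mem_unitBallENN hN
  have hhalf : (1 / 2 : ℝ) ∈ Ioo (0 : ℝ) 1 := by norm_num
  have hne := hardyH_iterate_ne_zero hw hκN.1 (fun t _ => by exact_mod_cast hκ) j hhalf
  -- The image of the constant `κ` is nonincreasing and exceeds `δ` at `1/2`, so near 0 its tails
  -- dominate `δ` times indicators of intervals `(0,t)`.
  obtain ⟨δ, hδ0, hδ⟩ := ENNReal.lt_iff_exists_nnreal_btwn.1 (pos_iff_ne_zero.2 hne)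
  have hδ0' : 0 < δ := by exact_mod_cast hδ0
  rw [ENNReal.tendsto_nhds_zero]
  intro ε hε
  obtain ⟨η, hη0, hη⟩ := ENNReal.lt_iff_exists_nnreal_btwn.1 hε
  obtain ⟨a, ha, haM⟩ := h (δ * η) (mul_pos hδ0' (by exact_mod_cast hη0))
  filter_upwards [Ioo_mem_nhdsGT (lt_min ha.1 hhalf.1)] with t ht
  have hind : AEMeasurable ((Ioo 0 t).indicator (1 : ℝ → ℝ≥0∞)) unitMeasure :=
    aemeasurable_one.indicator measurableSet_Ioo
  have hle : (δ : ℝ≥0∞) * fundamental M t ≤ δ * η := by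
    rw [fundamental, ← hM.smul _ hind, ← ENNReal.coe_mul]
    refine (hM.mono _ _ (hind.const_mul _)
      ((aemeasurable_hardyH_iterate w hκN.1 j).indicator measurableSet_Ioo)
      (.of_forall fun s => ?_)).trans (haM _ hκN)
    by_cases hs : s ∈ Ioo 0 t
    · have hsa : s ∈ Ioo 0 a := ⟨hs.1, hs.2.trans (ht.2.trans_le (min_le_left _ _))⟩
      simp only [hs, hsa, indicator_of_mem, Pi.one_apply, mul_one]
      exact hδ.le.trans (antitone_hardyH_iterate w _ hj
        (hs.2.trans (ht.2.trans_le (min_le_right _ _))).le)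
    · simp [hs]
  exact ((ENNReal.mul_le_mul_iff_right (by exact_mod_cast hδ0'.ne') ENNReal.coe_ne_top).1 hle).trans
    hη.le

end Tail

/-! ### From small tails to compactness. -/

/-- Helly's selection theorem. -/
lemma exists_subseq_tendsto_of_antitone {u : ℕ → ℝ → ℝ≥0∞} (hu : ∀ n, Antitone (u n)) :
    ∃ v : ℝ → ℝ≥0∞, Antitone v ∧ ∃ φ : ℕ → ℕ, StrictMono φ ∧
      ∀ᵐ t ∂unitMeasure, Tendsto (fun n => u (φ n) t) atTop (𝓝 (v t)) := by
  -- Compactness of `[0,∞]^ℚ` gives convergence at the rationals; the right limits of `L` define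
  -- `v`, and convergence holds wherever `v` is continuous, hence off a countable set.
  obtain ⟨L, φ, hφ, hL⟩ := SeqCompactSpace.tendsto_subseq fun n (q : ℚ) => u n q
  rw [tendsto_pi_nhds] at hL
  have hv : Antitone fun t : ℝ => ⨆ (q : ℚ) (_ : t < q), L q := fun s t hst =>
    iSup₂_le fun q hq => le_iSup₂ (f := fun (q : ℚ) (_ : s < q) => L q) q (hst.trans_lt hq)
  refine ⟨_, hv, φ, hφ, ?_⟩
  have hc : ∀ᵐ t ∂unitMeasure, ContinuousAt (fun t : ℝ => ⨆ (q : ℚ) (_ : t < q), L q) t :=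
    ae_restrict_of_ae (hv.countable_not_continuousAt.ae_notMem volume |>.mono fun t ht => by
      simpa using ht)
  filter_upwards [hc] with t ht
  refine tendsto_of_le_liminf_of_limsup_le (iSup₂_le fun q hq => ?_) ?_
  · rw [← (hL q).liminf_eq]
    exact liminf_le_liminf (.of_forall fun n => hu _ hq.le)
  · have hleft : Tendsto (fun s : ℝ => ⨆ (q : ℚ) (_ : s < q), L q) (𝓝[<] t)
        (𝓝 (⨆ (q : ℚ) (_ : t < q), L q)) := ht.tendsto.mono_left nhdsWithin_le_nhds
    refine ge_of_tendsto hleft ?_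
    filter_upwards [self_mem_nhdsWithin] with s hs
    obtain ⟨q, hsq, hqt⟩ := exists_rat_btwn (mem_Iio.1 hs)
    refine le_trans ?_ (le_iSup₂ (f := fun (q : ℚ) (_ : s < q) => L q) q hsq)
    rw [← (hL q).limsup_eq]
    exact limsup_le_limsup (.of_forall fun n => hu _ hqt.le)

lemma abs_coe_sub_coe_le {x y : ℝ≥0∞} (hx : x ≠ ∞) (hy : y ≠ ∞) :
    ((x : EReal) - (y : EReal)).abs ≤ (x - y) + (y - x) := by
  lift x to ℝ≥0 using hx
  lift y to ℝ≥0 using hy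
  change (((x : ℝ) : EReal) - ((y : ℝ) : EReal)).abs ≤ _
  rw [← EReal.coe_sub, EReal.abs_def]
  rcases le_total x y with h | h
  · rw [abs_of_nonpos (by simpa using h), neg_sub, ENNReal.ofReal_sub _ x.coe_nonneg]
    simp
  · rw [abs_of_nonneg (by simpa using h), ENNReal.ofReal_sub _ y.coe_nonneg]
    simp

section Compactness

variable {w : ℝ → ℝ≥0∞} {M N : (ℝ → ℝ≥0∞) → ℝ≥0∞}

lemma IsRINormENN.le_mul_of_unitBall (hN : IsRINormENN N) (hM : IsRINormENN M)
    (w : ℝ → ℝ≥0∞) (j : ℕ) {a : ℝ} {ε C : ℝ≥0} (hC : 0 < C)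
    (h : ∀ u ∈ unitBallENN N, M ((Ioo 0 a).indicator ((hardyH w)^[j] u)) ≤ ε)
    {u : ℝ → ℝ≥0∞} (hu : AEMeasurable u unitMeasure) (huC : N u ≤ C) :
    M ((Ioo 0 a).indicator ((hardyH w)^[j] u)) ≤ C * ε := by
  have hC' : (C : ℝ≥0∞) ≠ 0 := by exact_mod_cast hC.ne'
  have hmem : (fun t => ((C⁻¹ : ℝ≥0) : ℝ≥0∞) * u t) ∈ unitBallENN N := by
    refine ⟨hu.const_mul _, ?_⟩
    rw [hN.smul _ hu, ENNReal.coe_inv hC.ne', mul_comm, ← div_eq_mul_inv]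
    exact ENNReal.div_le_of_le_mul (by simpa using huC)
  have h1 := h _ hmem
  rw [hardyH_iterate_const_mul ENNReal.coe_ne_top] at h1
  have h2 : (Ioo 0 a).indicator (fun t => ((C⁻¹ : ℝ≥0) : ℝ≥0∞) * (hardyH w)^[j] u t) =
      fun t => ((C⁻¹ : ℝ≥0) : ℝ≥0∞) * (Ioo 0 a).indicator ((hardyH w)^[j] u) t := by
    ext t
    by_cases ht : t ∈ Ioo 0 a <;> simp [ht]
  rw [h2, hM.smul _ ((aemeasurable_hardyH_iterate w hu j).indicator measurableSet_Ioo),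
    ENNReal.coe_inv hC.ne', mul_comm, ← div_eq_mul_inv,
    ENNReal.div_le_iff hC' ENNReal.coe_ne_top, mul_comm] at h1
  exact h1

lemma le_indicator_add (a : ℝ) {u : ℝ → ℝ≥0∞} {B : ℝ≥0∞}
    (h : ∀ᵐ t ∂unitMeasure, a ≤ t → u t ≤ B) :
    u ≤ᵐ[unitMeasure] fun t => (Ioo 0 a).indicator u t + B := by
  filter_upwards [h, ae_mem_Ioo] with t ht ht0
  rcases lt_or_ge t a with hta | hta
  · simp [show t ∈ Ioo 0 a from ⟨ht0.1, hta⟩]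
  · exact (ht hta).trans le_add_self

lemma IsRINormENN.lt_top_of_indicator (hM : IsRINormENN M) {a : ℝ} {u : ℝ → ℝ≥0∞} {B : ℝ≥0}
    (hu : AEMeasurable u unitMeasure) (h : ∀ᵐ t ∂unitMeasure, a ≤ t → u t ≤ B)
    (hfin : M ((Ioo 0 a).indicator u) < ∞) : M u < ∞ := by
  have hm := hu.indicator (measurableSet_Ioo (a := 0) (b := a))
  refine (hM.mono _ _ hu (hm.add aemeasurable_const) (le_indicator_add a h)).trans_lt ?_
  exact (hM.add_le _ _ hm aemeasurable_const).trans_lt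
    (ENNReal.add_lt_top.2 ⟨hfin, hM.const_lt_top B⟩)

/-- Uniform decay of the tails at the origin yields compactness. -/
theorem exists_subseq_tendsto_of_tail (hM : IsRINormENN M) (hN : IsRINormENN N) (hw : IsWeight w)
    (i : ℕ)
    (h : ∀ ε : ℝ≥0, 0 < ε → ∃ a ∈ Ioo (0 : ℝ) 1, ∀ u ∈ unitBallENN N,
      M ((Ioo 0 a).indicator ((hardyH w)^[i + 1] u)) ≤ ε)
    {u : ℕ → ℝ → ℝ≥0∞} (hu : ∀ k, AEMeasurable (u k) unitMeasure) {C : ℝ≥0}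
    (huC : ∀ k, N (u k) ≤ C) :
    (∀ k, M ((hardyH w)^[i + 1] (u k)) < ∞) ∧
    ∃ v, AEMeasurable v unitMeasure ∧ M v < ∞ ∧ ∃ φ : ℕ → ℕ, StrictMono φ ∧
      Tendsto (fun k => M fun t =>
        (((hardyH w)^[i + 1] (u (φ k)) t : EReal) - (v t : EReal)).abs) atTop (𝓝 0) := by
  wlog hC : 0 < C generalizing C
  · exact this (C := C + 1) (fun k => (huC k).trans (by exact_mod_cast le_self_add))
      (by positivity)
  have hi : 1 ≤ i + 1 := Nat.le_add_left _ _
  set T : ℕ → ℝ → ℝ≥0∞ := fun k => (hardyH w)^[i + 1] (u k)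
  have hTm : ∀ k, AEMeasurable (T k) unitMeasure := fun k => aemeasurable_hardyH_iterate w (hu k) _
  have hTa : ∀ k, Antitone (T k) := fun k => antitone_hardyH_iterate w _ hi
  have htail : ∀ ε : ℝ≥0, 0 < ε → ∃ a ∈ Ioo (0 : ℝ) 1, ∀ k, M ((Ioo 0 a).indicator (T k)) ≤ ε := by
    intro ε hε
    obtain ⟨a, ha, haM⟩ := h (ε / C) (by positivity)
    refine ⟨a, ha, fun k => (hN.le_mul_of_unitBall hM w _ hC haM (hu k) (huC k)).trans_eq ?_⟩
    rw [← ENNReal.coe_mul, mul_div_cancel₀ _ hC.ne']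
  have hbound : ∀ a ∈ Ioo (0 : ℝ) 1, ∃ B : ℝ≥0, ∀ k t, a ≤ t → T k t ≤ B := by
    intro a ha
    obtain ⟨c, hc⟩ := hw.exists_le
    obtain ⟨K, hK⟩ := hN.integral_le
    have hfin : (c / ENNReal.ofReal a) ^ (i + 1) * (K * C) ≠ ∞ :=
      ENNReal.mul_ne_top (ENNReal.pow_ne_top
        (ENNReal.div_ne_top ENNReal.coe_ne_top (by simpa using ha.1)))
        (ENNReal.mul_ne_top ENNReal.coe_ne_top ENNReal.coe_ne_top)
    refine ⟨((c / ENNReal.ofReal a) ^ (i + 1) * (K * C)).toNNReal, fun k t ht => ?_⟩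
    rw [ENNReal.coe_toNNReal hfin]
    refine (hTa k ht).trans ((hardyH_iterate_le hc _ i ha).trans ?_)
    gcongr
    exact (hK _ (hu k)).trans (mul_le_mul_right (huC k) _)
  obtain ⟨v, hva, φ, hφ, hlim⟩ := exists_subseq_tendsto_of_antitone hTa
  have hvm : AEMeasurable v unitMeasure := hva.measurable.aemeasurable
  have hvB : ∀ a (B : ℝ≥0), (∀ k t, a ≤ t → T k t ≤ B) →
      ∀ᵐ t ∂unitMeasure, a ≤ t → v t ≤ B := fun a B hB => by
    filter_upwards [hlim] with t ht hat using le_of_tendsto' ht fun k => hB _ t hat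
  have hvtail : ∀ (a : ℝ) (ε : ℝ≥0), (∀ k, M ((Ioo 0 a).indicator (T k)) ≤ ε) →
      M ((Ioo 0 a).indicator v) ≤ ε := fun a ε hε =>
    hM.le_of_tendsto (u := fun k => (Ioo 0 a).indicator (T (φ k)))
      (fun k => (hTm _).indicator measurableSet_Ioo) (by
        filter_upwards [hlim] with t ht
        by_cases hta : t ∈ Ioo 0 a
        · simpa [hta] using ht
        · simp [hta]) fun k => hε _
  obtain ⟨a₁, ha₁, hM₁⟩ := htail 1 one_pos
  obtain ⟨B₁, hB₁⟩ := hbound a₁ ha₁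
  refine ⟨fun k => hM.lt_top_of_indicator (hTm k) (.of_forall fun t ht => hB₁ k t ht)
    ((hM₁ k).trans_lt ENNReal.coe_lt_top), v, hvm,
    hM.lt_top_of_indicator hvm (hvB a₁ B₁ hB₁) ((hvtail a₁ 1 hM₁).trans_lt ENNReal.coe_lt_top),
    φ, hφ, ?_⟩
  have hTfin : ∀ k, ∀ t ∈ Ioo (0 : ℝ) 1, T k t ≠ ∞ := fun k t ht => by
    obtain ⟨B, hB⟩ := hbound t ht
    exact ne_top_of_le_ne_top ENNReal.coe_ne_top (hB k t le_rfl)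
  have hvfin : ∀ᵐ t ∂unitMeasure, v t ≠ ∞ := by
    have : ∀ t ∈ Ioo (0 : ℝ) 1, v t ≠ ∞ := by
      intro t ht
      obtain ⟨B, hB⟩ := hbound (t / 2) ⟨by linarith [ht.1], by linarith [ht.1, ht.2]⟩
      by_contra htop
      -- The bound on `v` is known only a.e., but by monotonicity `v t = ∞` would violate it on the
      -- whole interval `(t/2, t)`.
      have h0 : unitMeasure (Ioo (t / 2) t) = 0 := by
        refine measure_mono_null (fun s hs => ?_) (ae_iff.1 (hvB _ B hB))
        simp only [mem_ofPred_eq, not_forall, not_le]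
        exact ⟨hs.1.le, ENNReal.coe_lt_top.trans_le (htop.symm.le.trans (hva hs.2.le))⟩
      rw [unitMeasure, Measure.restrict_apply measurableSet_Ioo, inter_eq_left.2
        (Ioo_subset_Ioo (by linarith [ht.1]) ht.2.le), Real.volume_Ioo,
        ENNReal.ofReal_eq_zero] at h0
      linarith [ht.1]
    filter_upwards [ae_mem_Ioo] with t ht using this t ht
  set D : ℕ → ℝ → ℝ≥0∞ := fun k t => (T (φ k) t - v t) + (v t - T (φ k) t)
  have hDm : ∀ k, AEMeasurable (D k) unitMeasure := fun k =>
    ((hTm _).sub hvm).add (hvm.sub (hTm _))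
  have hDlim : ∀ᵐ t ∂unitMeasure, Tendsto (fun k => D k t) atTop (𝓝 0) := by
    filter_upwards [hlim, hvfin] with t ht hvt
    have h1 := ENNReal.Tendsto.sub ht (tendsto_const_nhds (x := v t)) (Or.inr hvt)
    have h2 := ENNReal.Tendsto.sub (tendsto_const_nhds (x := v t)) ht (Or.inl hvt)
    simpa using h1.add h2
  have hphi := hM.tendsto_fundamental_of_tail hN hw hi h
  have hEm : ∀ (δ : ℝ≥0) k, NullMeasurableSet {t | (δ : ℝ≥0∞) < D k t} unitMeasure := fun δ k =>
    nullMeasurableSet_lt aemeasurable_const (hDm k)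
  -- Convergence a.e. implies convergence in measure, and the fundamental function turns small
  -- measure into small norm.
  have hE : ∀ δ : ℝ≥0, 0 < δ →
      Tendsto (fun k => M ({t | (δ : ℝ≥0∞) < D k t}.indicator 1)) atTop (𝓝 0) := by
    intro δ hδ
    have h1 : Tendsto (fun k => ∫⁻ t, {t | (δ : ℝ≥0∞) < D k t}.indicator 1 t ∂unitMeasure) atTop
        (𝓝 (∫⁻ _, 0 ∂unitMeasure)) := by
      refine tendsto_lintegral_of_dominated_convergence' (fun _ => 1)
        (fun k => aemeasurable_one.indicator₀ (hEm δ k))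
        (fun k => .of_forall fun t => indicator_le_self' (fun _ _ => zero_le) t) (by simp) ?_
      filter_upwards [hDlim] with t ht
      refine tendsto_const_nhds.congr' ?_
      filter_upwards [ht.eventually (gt_mem_nhds (show (0 : ℝ≥0∞) < δ by exact_mod_cast hδ))]
        with k hk
      simp [hk.le]
    simp only [lintegral_indicator_one₀ (hEm δ _), lintegral_zero] at h1
    rw [ENNReal.tendsto_nhds_zero]
    intro ε hε
    obtain ⟨b, hb0, hb⟩ := mem_nhdsGT_iff_exists_Ioo_subset.1
      ((ENNReal.tendsto_nhds_zero.1 hphi) ε hε)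
    obtain ⟨a, ha0, hab⟩ := exists_between (mem_Ioi.1 hb0)
    filter_upwards [(ENNReal.tendsto_nhds_zero.1 h1) (ENNReal.ofReal a) (by simpa using ha0)]
      with k hk
    rw [hM.indicator_one_eq (hEm δ k)]
    exact (hM.fundamental_mono (ENNReal.toReal_le_of_le_ofReal ha0.le hk)).trans (hb ⟨ha0, hab⟩)
  rw [ENNReal.tendsto_nhds_zero]
  intro ε hε
  obtain ⟨η, hη0, hη⟩ := ENNReal.lt_iff_exists_nnreal_btwn.1 hε
  have hη0' : 0 < η := by exact_mod_cast hη0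
  set m := (M fun _ => 1).toNNReal
  have hm : M (fun _ => 1) = m := (ENNReal.coe_toNNReal hM.one_lt_top.ne).symm
  -- Three terms of size `δ` come from the two tails and from the set `{D > δ}`; the constant `δ`
  -- itself has norm `δ m`.
  set δ : ℝ≥0 := η / (3 + m) with hδ
  have hδ0 : 0 < δ := by positivity
  obtain ⟨a, ha, haM⟩ := htail δ hδ0
  obtain ⟨B, hB⟩ := hbound a ha
  have hEB : Tendsto (fun k => ((2 * B : ℝ≥0) : ℝ≥0∞) * M ({t | (δ : ℝ≥0∞) < D k t}.indicator 1))
      atTop (𝓝 0) := by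
    have := ENNReal.Tendsto.const_mul (a := ((2 * B : ℝ≥0) : ℝ≥0∞)) (hE δ hδ0)
      (Or.inr ENNReal.coe_ne_top)
    rwa [mul_zero] at this
  filter_upwards [ENNReal.tendsto_nhds_zero.1 hEB δ (by exact_mod_cast hδ0)] with k hk
  have hm1 : AEMeasurable ((Ioo 0 a).indicator (T (φ k))) unitMeasure :=
    (hTm _).indicator measurableSet_Ioo
  have hm2 : AEMeasurable ((Ioo 0 a).indicator v) unitMeasure := hvm.indicator measurableSet_Ioo
  have hm3 : AEMeasurable ({t | (δ : ℝ≥0∞) < D k t}.indicator (1 : ℝ → ℝ≥0∞)) unitMeasure :=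
    aemeasurable_one.indicator₀ (hEm δ k)
  have hm4 : AEMeasurable (fun t => ((2 * B : ℝ≥0) : ℝ≥0∞) *
    {t | (δ : ℝ≥0∞) < D k t}.indicator 1 t) unitMeasure := hm3.const_mul _
  have hmabs : AEMeasurable (fun t => ((T (φ k) t : EReal) - (v t : EReal)).abs) unitMeasure :=
    measurable_abs.comp_aemeasurable
      (AEMeasurable.sub (measurable_coe_ennreal_ereal.comp_aemeasurable (hTm _))
        (measurable_coe_ennreal_ereal.comp_aemeasurable hvm))
  have hpt : (fun t => ((T (φ k) t : EReal) - (v t : EReal)).abs) ≤ᵐ[unitMeasure] fun t =>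
      ((Ioo 0 a).indicator (T (φ k)) t + (Ioo 0 a).indicator v t) +
        ((δ : ℝ≥0∞) + ((2 * B : ℝ≥0) : ℝ≥0∞) * {t | (δ : ℝ≥0∞) < D k t}.indicator 1 t) := by
    filter_upwards [ae_mem_Ioo, hvfin, hvB a B hB] with t ht hvt hvBt
    refine (abs_coe_sub_coe_le (hTfin _ t ht) hvt).trans ?_
    rcases lt_or_ge t a with hta | hta
    · rw [indicator_of_mem (show t ∈ Ioo 0 a from ⟨ht.1, hta⟩),
        indicator_of_mem (show t ∈ Ioo 0 a from ⟨ht.1, hta⟩)]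
      exact (add_le_add tsub_le_self tsub_le_self).trans le_self_add
    · refine le_trans ?_ le_add_self
      by_cases hD : (δ : ℝ≥0∞) < D k t
      · refine le_trans ?_ le_add_self
        simp only [mem_ofPred_eq, hD, indicator_of_mem, Pi.one_apply, mul_one]
        refine (add_le_add (tsub_le_self.trans (hB _ t hta)) (tsub_le_self.trans (hvBt hta))).trans ?_
        rw [← ENNReal.coe_add, two_mul]
      · exact (not_lt.1 hD).trans le_self_add
  calc M (fun t => ((T (φ k) t : EReal) - (v t : EReal)).abs)
      ≤ (M ((Ioo 0 a).indicator (T (φ k))) + M ((Ioo 0 a).indicator v)) +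
        (M (fun _ => (δ : ℝ≥0∞)) + M (fun t => ((2 * B : ℝ≥0) : ℝ≥0∞) *
          {t | (δ : ℝ≥0∞) < D k t}.indicator 1 t)) :=
        (hM.mono _ _ hmabs ((hm1.add hm2).add (aemeasurable_const.add hm4)) hpt).trans
          ((hM.add_le _ _ (hm1.add hm2) (aemeasurable_const.add hm4)).trans
            (add_le_add (hM.add_le _ _ hm1 hm2) (hM.add_le _ _ aemeasurable_const hm4)))
    _ ≤ (δ + δ) + (δ * m + δ) := by
        have hconst := hM.smul (fun _ => 1) aemeasurable_const δ
        simp only [mul_one] at hconst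
        rw [hconst, hm, hM.smul _ hm3]
        exact add_le_add (add_le_add (haM _) (hvtail a δ haM)) (add_le_add le_rfl hk)
    _ = η := by
        have : δ * (3 + m) = η := div_mul_cancel₀ _ (by positivity)
        rw [← this]
        push_cast
        ring
    _ ≤ ε := hη.le

/-! ### From compactness to small tails. -/

/-- Compactness yields uniform decay at the origin of the images of functions supported near the
origin. -/
lemma exists_forall_hardyH_indicator_le (hN : IsRINormENN N) (j : ℕ)
    (h : ∀ u : ℕ → ℝ → ℝ≥0∞, (∀ k, u k ∈ unitBallENN N) →
      (∀ t ∈ Ioo (0 : ℝ) 1, ∀ᶠ k in atTop, (hardyH w)^[j] (u k) t = 0) →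
      ∃ φ : ℕ → ℕ, StrictMono φ ∧
        Tendsto (fun k => M ((hardyH w)^[j] (u (φ k)))) atTop (𝓝 0))
    {ε : ℝ≥0∞} (hε : 0 < ε) :
    ∃ b ∈ Ioo (0 : ℝ) 1, ∀ u ∈ unitBallENN N, M ((hardyH w)^[j] ((Ioo 0 b).indicator u)) ≤ ε := by
  by_contra! hcon
  -- If every `b` fails, choose a bad function for each `b = 1/(k+2)`; the shift by 2 keeps `b`
  -- below 1.
  have hb : ∀ k : ℕ, (1 / (k + 2) : ℝ) ∈ Ioo (0 : ℝ) 1 := fun k =>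
    ⟨by positivity, by rw [div_lt_one (by positivity)]; linarith [k.cast_nonneg (α := ℝ)]⟩
  choose u hu hlt using fun k : ℕ => hcon _ (hb k)
  obtain ⟨φ, -, hφ⟩ := h (fun k => (Ioo 0 (1 / (k + 2) : ℝ)).indicator (u k))
    (fun k => ⟨(hu k).1.indicator measurableSet_Ioo, (hN.mono _ _
      ((hu k).1.indicator measurableSet_Ioo) (hu k).1
      (.of_forall fun t => indicator_le_self _ _ t)).trans (hu k).2⟩)
    (fun t ht => by
      obtain ⟨n, hn⟩ := exists_nat_gt (1 / t)
      filter_upwards [eventually_ge_atTop n] with k hk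
      refine hardyH_iterate_eq_zero (b := 1 / (k + 2)) (fun s hs => ?_) j ?_
      · exact indicator_of_notMem (fun hmem => hs.not_gt hmem.2) _
      · rw [div_le_iff₀ (by positivity)]
        rw [div_lt_iff₀ ht.1] at hn
        have : (n : ℝ) ≤ k := by exact_mod_cast hk
        nlinarith [ht.1])
  obtain ⟨k, hk⟩ := ((ENNReal.tendsto_nhds_zero.1 hφ) ε hε).exists
  exact (hlt (φ k)).not_ge hk

/-- Each integration contributes at most one factor `∫ w`. The bound serves for integrable `w`,
where it makes the iterates of 1 bounded. -/
lemma hardyH_iterate_one_le_pow (i : ℕ) {t : ℝ} (ht : t ∈ Ioo (0 : ℝ) 1) :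
    (hardyH w)^[i] (fun _ => 1) t ≤ (∫⁻ s, w s ∂unitMeasure) ^ i := by
  induction i generalizing t with
  | zero => simp
  | succ i ih =>
    rw [Function.iterate_succ_apply', pow_succ]
    rcases eq_or_ne (∫⁻ s, w s ∂unitMeasure) ∞ with htop | htop
    · rcases eq_or_ne i 0 with rfl | hi0
      · simp [htop]
      · rw [htop, ENNReal.top_pow hi0, ENNReal.top_mul_top]
        exact le_top
    rw [← lintegral_const_mul' _ _ (ENNReal.pow_ne_top htop)]
    exact (setLIntegral_mono_ae' measurableSet_Ioo (.of_forall fun s hs =>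
      mul_le_mul_left (ih ⟨ht.1.trans hs.1, hs.2⟩) _)).trans
      (lintegral_mono' (restrict_Ioo_le ht.1.le le_rfl) le_rfl)

/-- The iterate of the constant function that precedes the target order has small tails. -/
lemma IsRINormENN.exists_indicator_hardyH_one_le (hM : IsRINormENN M) (hw : IsWeight w) (i : ℕ)
    (hor : Tendsto (fundamental M) (𝓝[>] 0) (𝓝 0) ∨ ∫⁻ s, w s ∂unitMeasure = ∞)
    (hfin : M ((hardyH w)^[i + 1] fun _ => 1) < ∞) {ε : ℝ≥0∞} (hε : 0 < ε) :
    ∃ a ∈ Ioo (0 : ℝ) 1, M ((Ioo 0 a).indicator ((hardyH w)^[i] fun _ => 1)) ≤ ε := by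
  have hm : ∀ i, AEMeasurable ((hardyH w)^[i] fun _ => 1) unitMeasure := fun i =>
    aemeasurable_hardyH_iterate w aemeasurable_const i
  have hmi : ∀ a, AEMeasurable ((Ioo 0 a).indicator ((hardyH w)^[i] fun _ => 1)) unitMeasure :=
    fun a => (hm i).indicator measurableSet_Ioo
  -- For nonintegrable `w`, near 0 the iterate is a small multiple of the next one, whose norm is
  -- finite. Otherwise it is bounded, and the fundamental function controls its tail.
  by_cases hdiv : ∫⁻ s, w s ∂unitMeasure = ∞
  · obtain ⟨η, hη0, hη⟩ := ENNReal.lt_iff_exists_nnreal_btwn.1 hε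
    have hη0' : 0 < η := by exact_mod_cast hη0
    set m := (M ((hardyH w)^[i + 1] fun _ => 1)).toNNReal
    have hmM : M ((hardyH w)^[i + 1] fun _ => 1) = m := (ENNReal.coe_toNNReal hfin.ne).symm
    obtain ⟨b, hb0, hb⟩ := mem_nhdsGT_iff_exists_Ioo_subset.1
      ((hardyH_iterate_one_le hw hdiv i).2 (η / (m + 1)) (by positivity))
    obtain ⟨a, ha0, hab⟩ := exists_between (lt_min (mem_Ioi.1 hb0) one_pos)
    refine ⟨a, ⟨ha0, hab.trans_le (min_le_right _ _)⟩, ?_⟩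
    calc M ((Ioo 0 a).indicator ((hardyH w)^[i] fun _ => 1))
        ≤ M (fun t => ((η / (m + 1) : ℝ≥0) : ℝ≥0∞) * (hardyH w)^[i + 1] (fun _ => 1) t) := by
          refine hM.mono _ _ (hmi a) ((hm (i + 1)).const_mul _) (.of_forall fun t => ?_)
          by_cases hta : t ∈ Ioo 0 a
          · rw [indicator_of_mem hta]
            exact hb ⟨hta.1, hta.2.trans (hab.trans_le (min_le_left _ _))⟩
          · simp [hta]
      _ ≤ η := by
          rw [hM.smul _ (hm (i + 1)), hmM, ← ENNReal.coe_mul, ENNReal.coe_le_coe]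
          rw [div_mul_eq_mul_div]
          exact div_le_of_le_mul₀ (by positivity) (by positivity)
            (mul_le_mul_right le_self_add _)
      _ ≤ ε := hη.le
  · have hphi := hor.resolve_right hdiv
    have hK : (∫⁻ s, w s ∂unitMeasure) ^ i ≠ ∞ := ENNReal.pow_ne_top hdiv
    have hlim : Tendsto (fun a => (∫⁻ s, w s ∂unitMeasure) ^ i * fundamental M a) (𝓝[>] 0)
        (𝓝 0) := by
      have := ENNReal.Tendsto.const_mul hphi (Or.inr hK)
      rwa [mul_zero] at this
    obtain ⟨a, haM, ha⟩ := ((ENNReal.tendsto_nhds_zero.1 hlim ε hε).and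
      (Ioo_mem_nhdsGT one_pos)).exists
    refine ⟨a, ha, le_trans ?_ haM⟩
    have hone : AEMeasurable ((Ioo 0 a).indicator (1 : ℝ → ℝ≥0∞)) unitMeasure :=
      aemeasurable_one.indicator measurableSet_Ioo
    rw [← ENNReal.coe_toNNReal hK, fundamental, ← hM.smul _ hone]
    refine hM.mono _ _ (hmi a) (hone.const_mul _) ?_
    filter_upwards [ae_mem_Ioo] with t ht
    by_cases hta : t ∈ Ioo 0 a
    · rw [indicator_of_mem hta, indicator_of_mem hta, Pi.one_apply, mul_one,
        ENNReal.coe_toNNReal hK]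
      exact hardyH_iterate_one_le_pow i ht
    · simp [hta]

/-- Compactness yields uniform decay of the tails at the origin. -/
theorem exists_tail_le_of_compact (hM : IsRINormENN M) (hN : IsRINormENN N) (hw : IsWeight w)
    (i : ℕ)
    (hor : Tendsto (fundamental M) (𝓝[>] 0) (𝓝 0) ∨ ∫⁻ s, w s ∂unitMeasure = ∞)
    (hfin : M ((hardyH w)^[i + 1] fun _ => 1) < ∞)
    (h : ∀ u : ℕ → ℝ → ℝ≥0∞, (∀ k, u k ∈ unitBallENN N) →
      (∀ t ∈ Ioo (0 : ℝ) 1, ∀ᶠ k in atTop, (hardyH w)^[i + 1] (u k) t = 0) →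
      ∃ φ : ℕ → ℕ, StrictMono φ ∧
        Tendsto (fun k => M ((hardyH w)^[i + 1] (u (φ k)))) atTop (𝓝 0))
    {ε : ℝ≥0} (hε : 0 < ε) :
    ∃ a ∈ Ioo (0 : ℝ) 1, ∀ u ∈ unitBallENN N,
      M ((Ioo 0 a).indicator ((hardyH w)^[i + 1] u)) ≤ ε := by
  obtain ⟨b, hb, hbM⟩ := exists_forall_hardyH_indicator_le hN (i + 1) h
    (show (0 : ℝ≥0∞) < (ε / 2 : ℝ≥0) by exact_mod_cast half_pos hε)
  obtain ⟨c, hc⟩ := hw.exists_le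
  obtain ⟨C, hC⟩ := hN.integral_le
  have hKtop : c / ENNReal.ofReal b * C ≠ ∞ := ENNReal.mul_ne_top
    (ENNReal.div_ne_top ENNReal.coe_ne_top (by simpa using hb.1)) ENNReal.coe_ne_top
  -- `K` bounds `H (χ_[b,1) u)` uniformly over the unit ball; the other `i` applications of H then
  -- act on a constant.
  set K := (c / ENNReal.ofReal b * C).toNNReal
  have hK : c / ENNReal.ofReal b * C = K := (ENNReal.coe_toNNReal hKtop).symm
  obtain ⟨a, ha, haM⟩ := hM.exists_indicator_hardyH_one_le hw i hor hfin
    (show (0 : ℝ≥0∞) < (ε / 2 / (K + 1) : ℝ≥0) by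
      exact_mod_cast (by positivity : 0 < ε / 2 / (K + 1)))
  refine ⟨a, ha, fun u hu => ?_⟩
  have hu1 : AEMeasurable ((Ioo 0 b).indicator u) unitMeasure := hu.1.indicator measurableSet_Ioo
  have hm1 := aemeasurable_hardyH_iterate w hu1 (i + 1)
  have hone : AEMeasurable ((Ioo 0 a).indicator ((hardyH w)^[i] fun _ => 1)) unitMeasure :=
    (aemeasurable_hardyH_iterate w aemeasurable_const i).indicator measurableSet_Ioo
  have hsplit : u ≤ᵐ[unitMeasure] fun t => (Ioo 0 b).indicator u t + (Ici b).indicator u t := by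
    filter_upwards [ae_mem_Ioo] with t ht
    rcases lt_or_ge t b with htb | htb
    · rw [indicator_of_mem (show t ∈ Ioo 0 b from ⟨ht.1, htb⟩)]
      exact le_self_add
    · rw [indicator_of_mem (show t ∈ Ici b from htb)]
      exact le_add_self
  have hfar : hardyH w ((Ici b).indicator u) ≤ᵐ[unitMeasure] fun _ => K * 1 := by
    filter_upwards [ae_mem_Ioo] with t ht
    refine (hardyH_le_of_support hc hb.1 (fun s hs => indicator_of_notMem hs.not_ge _)
      ht.1.le).trans ?_
    rw [mul_one, ← hK]
    gcongr
    refine (lintegral_mono fun s => indicator_le_self _ _ s).trans ((hC u hu.1).trans ?_)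
    exact mul_le_of_le_one_right' hu.2
  have hfar' := hardyH_iterate_mono (w := w) hfar i
  rw [hardyH_iterate_const_mul ENNReal.coe_ne_top, ← Function.iterate_succ_apply] at hfar'
  calc M ((Ioo 0 a).indicator ((hardyH w)^[i + 1] u))
      ≤ M (fun t => (hardyH w)^[i + 1] ((Ioo 0 b).indicator u) t +
          K * (Ioo 0 a).indicator ((hardyH w)^[i] fun _ => 1) t) := by
        refine hM.mono _ _
          ((aemeasurable_hardyH_iterate w hu.1 _).indicator measurableSet_Ioo)
          (hm1.add (hone.const_mul _)) ?_
        filter_upwards [hardyH_iterate_add_le hw.aemeasurable hu1 hsplit (i + 1), hfar']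
          with t h1 h2
        by_cases hta : t ∈ Ioo 0 a
        · rw [indicator_of_mem hta, indicator_of_mem hta]
          exact h1.trans (add_le_add le_rfl h2)
        · simp [hta]
    _ ≤ (ε / 2 : ℝ≥0) + K * (ε / 2 / (K + 1) : ℝ≥0) := by
        refine (hM.add_le _ _ hm1 (hone.const_mul _)).trans ?_
        rw [hM.smul _ hone]
        exact add_le_add (hbM u hu) (mul_le_mul_right haM _)
    _ ≤ (ε / 2 : ℝ≥0) + (ε / 2 : ℝ≥0) := by
        gcongr
        rw [← ENNReal.coe_mul, ENNReal.coe_le_coe, mul_div_assoc']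
        refine div_le_of_le_mul₀ (by positivity) (by positivity) ?_
        rw [mul_comm]
        exact mul_le_mul_right le_self_add _
    _ = ε := by rw [← ENNReal.coe_add, add_halves]

end Compactness

/-! ### Translation back to extended-real-valued functions. -/

lemma isWeight_inv {J : ℝ → ℝ} (hJm : AEMeasurable J (volume.restrict (Ioc (0 : ℝ) 1)))
    (hJinf : ∃ c : ℝ, 0 < c ∧ ∀ t ∈ Ioc (0 : ℝ) 1, c ≤ J t / t) :
    IsWeight fun t => (ENNReal.ofReal (J t))⁻¹ where
  aemeasurable := (hJm.mono_measure (Measure.restrict_mono Ioo_subset_Ioc_self le_rfl)).ennreal_ofReal.inv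
  ne_zero t _ := ENNReal.inv_ne_zero.2 ENNReal.ofReal_ne_top
  exists_le := by
    obtain ⟨c, hc0, hc⟩ := hJinf
    refine ⟨(c.toNNReal)⁻¹, fun t ht => ?_⟩
    have h1 : c * t ≤ J t := (le_div_iff₀ ht.1).1 (hc t ⟨ht.1, ht.2.le⟩)
    rw [ENNReal.coe_inv (by simpa using hc0), div_eq_mul_inv, ← ENNReal.mul_inv (by simp) (by simp)]
    refine ENNReal.inv_le_inv.2 ((ENNReal.ofReal_le_ofReal h1).trans' ?_)
    rw [ENNReal.ofReal_mul hc0.le]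
    rfl

lemma opHPow_eq (J : ℝ → ℝ) {j : ℕ} (hj : 1 ≤ j) (f : ℝ → EReal) :
    opHPow J j f = fun t =>
      ((hardyH (fun s => (ENNReal.ofReal (J s))⁻¹))^[j] (fun t => (f t).abs) t : EReal) := by
  induction j, hj using Nat.le_induction with
  | base => rfl
  | succ j _ ih =>
    rw [opHPow] at ih ⊢
    rw [Function.iterate_succ_apply', ih, Function.iterate_succ_apply']
    ext t
    simp only [opH, abs_coe_ennreal, hardyH, div_eq_mul_inv]

lemma opRPow_coe (J : ℝ → ℝ) (j : ℕ) (u : ℝ → ℝ≥0∞) :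
    opRPow J j (fun t => (u t : EReal)) = fun t =>
      ((hardyR (fun s => (ENNReal.ofReal (J s))⁻¹))^[j] u t : EReal) := by
  induction j with
  | zero => rfl
  | succ j ih =>
    rw [opRPow] at ih ⊢
    rw [Function.iterate_succ_apply', ih, Function.iterate_succ_apply']
    ext t
    simp only [opR, abs_coe_ennreal, hardyR, div_eq_mul_inv]

lemma abs_mem_unitBallENN {ρ : (ℝ → EReal) → ℝ≥0∞}
    (hρ : ∀ f, MemM f → ρ f = posNorm ρ fun t => (f t).abs) {f : ℝ → EReal}
    (hf : f ∈ unitBall ρ) : (fun t => (f t).abs) ∈ unitBallENN (posNorm ρ) :=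
  ⟨hf.1.abs, (hρ f hf.1).symm.trans_le hf.2⟩

lemma coe_mem_unitBall {ρ : (ℝ → EReal) → ℝ≥0∞} {u : ℝ → ℝ≥0∞}
    (hu : u ∈ unitBallENN (posNorm ρ)) : (fun t => (u t : EReal)) ∈ unitBall ρ :=
  ⟨memM_coe hu.1, hu.2⟩

/-- Only dependence on `|f|` is assumed, because the lemma is also applied to `rangeNormDual`, for
which the axioms of a norm are never established. -/
lemma associateNorm_eq {ρ : (ℝ → EReal) → ℝ≥0∞}
    (hρ : ∀ f, MemM f → ρ f = posNorm ρ fun t => (f t).abs) (f : ℝ → EReal) :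
    associateNorm ρ f = dualENN (posNorm ρ) fun t => (f t).abs := by
  refine le_antisymm (iSup₂_le fun g hg => ?_) (iSup₂_le fun u hu => ?_)
  · simp only [EReal.abs_mul]
    exact lintegral_le_dualENN (abs_mem_unitBallENN hρ hg) _
  · refine le_trans (le_of_eq ?_) (le_iSup₂ (f := fun g (_ : g ∈ unitBall ρ) =>
      ∫⁻ t, (f t * g t).abs ∂unitMeasure) _ (coe_mem_unitBall hu))
    simp only [EReal.abs_mul, abs_coe_ennreal]

lemma rangeNormDual_eq (J : ℝ → ℝ) (j : ℕ) {X : (ℝ → EReal) → ℝ≥0∞} (hX : IsRINorm X)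
    (f : ℝ → EReal) :
    rangeNormDual J j X f = dualENN (posNorm X)
      ((hardyR (fun s => (ENNReal.ofReal (J s))⁻¹))^[j] (rearrENN fun t => (f t).abs)) := by
  have h : rearrangement f = fun t => (rearrENN (fun t => (f t).abs) t : EReal) := rfl
  rw [rangeNormDual, associateNorm_eq (fun _ => hX.eq_posNorm_abs), h, opRPow_coe]
  simp only [abs_coe_ennreal]

lemma rangeNorm_eq (J : ℝ → ℝ) (j : ℕ) {X : (ℝ → EReal) → ℝ≥0∞} (hX : IsRINorm X)
    (f : ℝ → EReal) :
    rangeNorm J j X f =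
      rangeENN (fun s => (ENNReal.ofReal (J s))⁻¹) j (posNorm X) fun t => (f t).abs := by
  have h : ∀ v, posNorm (rangeNormDual J j X) v = dualENN (posNorm X)
      ((hardyR (fun s => (ENNReal.ofReal (J s))⁻¹))^[j] (rearrENN v)) := fun v => by
    rw [posNorm, rangeNormDual_eq J j hX]
    simp only [abs_coe_ennreal]
  rw [rangeNorm, associateNorm_eq fun f _ => by
    rw [h, rangeNormDual_eq J j hX], rangeENN, funext h]

lemma indicator_coe (s : Set ℝ) (u : ℝ → ℝ≥0∞) :
    (s.indicator fun t => (u t : EReal)) = fun t => ((s.indicator u t : ℝ≥0∞) : EReal) := by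
  ext t
  by_cases ht : t ∈ s <;> simp [ht]

lemma abs_indicator (s : Set ℝ) (f : ℝ → EReal) :
    (fun t => (s.indicator f t).abs) = s.indicator fun t => (f t).abs := by
  ext t
  by_cases ht : t ∈ s <;> simp [ht]

/-! ### The three conditions and small tails. -/

section Conditions

variable {J : ℝ → ℝ} {j : ℕ} {X Y : (ℝ → EReal) → ℝ≥0∞}

/-- The images of the unit ball have uniformly small tails at the origin. -/
def SmallTails (J : ℝ → ℝ) (j : ℕ) (X Y : (ℝ → EReal) → ℝ≥0∞) : Prop :=
  ∀ ε : ℝ≥0, 0 < ε → ∃ a ∈ Ioo (0 : ℝ) 1, ∀ u ∈ unitBallENN (posNorm X),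
    posNorm Y ((Ioo 0 a).indicator ((hardyH fun s => (ENNReal.ofReal (J s))⁻¹)^[j] u)) ≤ ε

/-- The norm of the tail is monotone in `a`, so one good `a` for each `ε` already gives the limit.
-/
lemma tendsto_iff_smallTails (hj : 1 ≤ j) (hX : IsRINorm X) (hY : IsRINorm Y) :
    Tendsto (fun a : ℝ => ⨆ f ∈ unitBall X, Y ((Ioo 0 a).indicator (opHPow J j f)))
      (𝓝[>] (0 : ℝ)) (𝓝 0) ↔ SmallTails J j X Y := by
  rw [ENNReal.tendsto_nhds_zero]
  refine ⟨fun h ε hε => ?_, fun h ε hε => ?_⟩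
  · obtain ⟨a, haS, ha⟩ := ((h ε (by exact_mod_cast hε)).and (Ioo_mem_nhdsGT one_pos)).exists
    refine ⟨a, ha, fun u hu => ?_⟩
    refine le_trans (le_of_eq ?_) (iSup₂_le_iff.1 haS _ (coe_mem_unitBall hu))
    rw [opHPow_eq J hj, indicator_coe]
    simp only [abs_coe_ennreal]
    rfl
  · obtain ⟨η, hη0, hη⟩ := ENNReal.lt_iff_exists_nnreal_btwn.1 hε
    obtain ⟨a, ha, haS⟩ := h η (by exact_mod_cast hη0)
    filter_upwards [Ioo_mem_nhdsGT ha.1] with t ht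
    refine iSup₂_le fun f hf => ?_
    have hu := abs_mem_unitBallENN (fun _ => hX.eq_posNorm_abs) hf
    rw [opHPow_eq J hj, indicator_coe]
    exact (hY.posNorm.indicator_mono (aemeasurable_hardyH_iterate _ hu.1 j) measurableSet_Ioo
      measurableSet_Ioo (Ioo_subset_Ioo_right ht.2.le)).trans ((haS _ hu).trans hη.le)

lemma SmallTails.isCompactBetween (hw : IsWeight fun t => (ENNReal.ofReal (J t))⁻¹) (hj : 1 ≤ j)
    (hX : IsRINorm X) (hY : IsRINorm Y) (h : SmallTails J j X Y) :
    IsCompactBetween (opHPow J j) X Y := by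
  obtain ⟨i, rfl⟩ := Nat.exists_eq_add_of_le' hj
  have hmem : ∀ f, MemM f → MemM (opHPow J (i + 1) f) := fun f hf => by
    rw [opHPow_eq J hj]
    exact memM_coe (aemeasurable_hardyH_iterate _ hf.abs _)
  refine ⟨fun f hf hfX => ⟨hmem f hf, ?_⟩, fun F hF ⟨C, hC⟩ => ?_⟩
  · have h1 := (exists_subseq_tendsto_of_tail hY.posNorm hX.posNorm hw i h
      (u := fun _ t => (f t).abs) (fun _ => hf.abs) (C := (X f).toNNReal) (fun _ => by
        rw [← hX.eq_posNorm_abs hf, ENNReal.coe_toNNReal hfX.ne])).1 0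
    rw [opHPow_eq J hj]
    exact h1
  · obtain ⟨-, v, hv, hvY, φ, hφ, hlim⟩ := exists_subseq_tendsto_of_tail hY.posNorm hX.posNorm hw i h
      (u := fun k t => (F k t).abs) (fun k => (hF k).abs) (C := C) (fun k => by
        rw [← hX.eq_posNorm_abs (hF k)]
        exact hC k)
    refine ⟨fun t => (v t : EReal), memM_coe hv, hvY, φ, hφ, hlim.congr fun k => ?_⟩
    have hd : MemM fun t => opHPow J (i + 1) (F (φ k)) t - (v t : EReal) :=
      (hmem _ (hF _)).sub (memM_coe hv)
    rw [hY.eq_posNorm_abs hd, opHPow_eq J hj]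

lemma IsCompactBetween.smallTails (hw : IsWeight fun t => (ENNReal.ofReal (J t))⁻¹) (hj : 1 ≤ j)
    (hX : IsRINorm X) (hY : IsRINorm Y)
    (hor : Tendsto (fundamental (posNorm Y)) (𝓝[>] 0) (𝓝 0) ∨
      ∫⁻ s, (ENNReal.ofReal (J s))⁻¹ ∂unitMeasure = ∞)
    (h : IsCompactBetween (opHPow J j) X Y) : SmallTails J j X Y := by
  obtain ⟨i, rfl⟩ := Nat.exists_eq_add_of_le' hj
  have hcoe : ∀ u : ℝ → ℝ≥0∞, opHPow J (i + 1) (fun t => (u t : EReal)) = fun t =>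
      ((hardyH (fun s => (ENNReal.ofReal (J s))⁻¹))^[i + 1] u t : EReal) := fun u => by
    rw [opHPow_eq J hj]
    simp only [abs_coe_ennreal]
  refine fun ε hε => exists_tail_le_of_compact hY.posNorm hX.posNorm hw i hor ?_ ?_ hε
  · have h1 := (h.1 _ (memM_coe (u := fun _ => 1) aemeasurable_const) hX.posNorm.one_lt_top).2
    rw [hcoe] at h1
    exact h1
  · intro u hu hzero
    obtain ⟨g, hg, -, φ, hφ, hlim⟩ := h.2 (fun k t => (u k t : EReal)) (fun k => memM_coe (hu k).1)
      ⟨1, fun k => (hu k).2.trans_eq ENNReal.coe_one.symm⟩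
    refine ⟨φ, hφ, ?_⟩
    simp only [hcoe] at hlim
    set T := fun k => (hardyH fun s => (ENNReal.ofReal (J s))⁻¹)^[i + 1] (u k) with hT
    have hTm : ∀ k, AEMeasurable (T k) unitMeasure := fun k =>
      aemeasurable_hardyH_iterate _ (hu k).1 _
    have hd : ∀ k, MemM fun t => (T (φ k) t : EReal) - g t := fun k => (memM_coe (hTm _)).sub hg
    have hYd : ∀ k, Y (fun t => (T (φ k) t : EReal) - g t) =
        posNorm Y fun t => ((T (φ k) t : EReal) - g t).abs := fun k => hY.eq_posNorm_abs (hd k)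
    -- At each point `|T (φ k) - g|` eventually equals `|g|`, so the Fatou property bounds the norm
    -- of `g` by every `η > 0`.
    have hg0 : posNorm Y (fun t => (g t).abs) = 0 := by
      refine le_antisymm (ENNReal.le_of_forall_pos_le_add fun η hη _ => ?_) zero_le
      obtain ⟨n, hn⟩ := eventually_atTop.1
        (ENNReal.tendsto_nhds_zero.1 hlim η (by exact_mod_cast hη))
      rw [zero_add]
      refine hY.posNorm.le_of_tendsto
        (u := fun k t => ((T (φ (k + n)) t : EReal) - g t).abs) (fun k => (hd _).abs) ?_
        fun k => (hYd _).symm.trans_le (hn _ (by omega))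
      filter_upwards [ae_mem_Ioo] with t ht
      refine tendsto_const_nhds.congr' ?_
      filter_upwards [(hφ.tendsto_atTop.comp (tendsto_add_atTop_nat n)).eventually (hzero t ht)]
        with k hk
      simp only [hT]
      rw [Function.comp_apply] at hk
      rw [hk, EReal.coe_ennreal_zero, zero_sub, EReal.abs_neg]
    have hgae := (hY.posNorm.eq_zero_iff _ hg.abs).1 hg0
    refine hlim.congr fun k => ?_
    rw [hYd]
    refine hY.posNorm.congr (hd k).abs ?_
    filter_upwards [hgae] with t ht
    rw [EReal.abs_eq_zero_iff.1 ht, sub_zero, abs_coe_ennreal]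

lemma AlmostCompactEmbedding.smallTails (hw : IsWeight fun t => (ENNReal.ofReal (J t))⁻¹)
    (hj : 1 ≤ j) (hX : IsRINorm X) (h : AlmostCompactEmbedding (rangeNorm J j X) Y) :
    SmallTails J j X Y := by
  intro ε hε
  have hb : ∀ k : ℕ, (1 / (k + 2) : ℝ) ∈ Ioo (0 : ℝ) 1 := fun k =>
    ⟨by positivity, by rw [div_lt_one (by positivity)]; linarith [k.cast_nonneg (α := ℝ)]⟩
  have h1 := h (fun k => Ioo 0 (1 / (k + 2) : ℝ)) (fun k => Ioo_subset_Ioo_right (hb k).2.le)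
    (fun k => measurableSet_Ioo.nullMeasurableSet) (by
      filter_upwards [ae_mem_Ioo] with t ht
      refine tendsto_const_nhds.congr' ?_
      obtain ⟨n, hn⟩ := exists_nat_gt (1 / t)
      filter_upwards [eventually_ge_atTop n] with k hk
      refine (indicator_of_notMem (fun hmem => hmem.2.not_ge ?_) _).symm
      rw [div_le_iff₀ (by positivity)]
      rw [div_lt_iff₀ ht.1] at hn
      have : (n : ℝ) ≤ k := by exact_mod_cast hk
      nlinarith [ht.1])
  obtain ⟨k, hk⟩ := (ENNReal.tendsto_nhds_zero.1 h1 ε (by exact_mod_cast hε)).exists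
  refine ⟨_, hb k, fun u hu => ?_⟩
  have hT := hardyH_iterate_mem_unitBallENN hw hj hu
  have hmem : (fun t => ((hardyH fun s => (ENNReal.ofReal (J s))⁻¹)^[j] u t : EReal)) ∈
      unitBall (rangeNorm J j X) :=
    ⟨memM_coe hT.1, by
      rw [rangeNorm_eq J j hX]
      simp only [abs_coe_ennreal]
      exact hT.2⟩
  have h2 := iSup₂_le_iff.1 hk _ hmem
  rwa [indicator_coe] at h2

lemma SmallTails.almostCompactEmbedding (hw : IsWeight fun t => (ENNReal.ofReal (J t))⁻¹)
    (hX : IsRINorm X) (hY : IsRINorm Y) (h : SmallTails J j X Y) :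
    AlmostCompactEmbedding (rangeNorm J j X) Y := by
  intro E _ hE hlim
  have hEm : ∀ k, NullMeasurableSet (E k) unitMeasure := fun k =>
    (hE k).mono_ac Measure.restrict_le_self.absolutelyContinuous
  have hE0 : Tendsto (fun k => unitMeasure (E k)) atTop (𝓝 0) := by
    have h1 : Tendsto (fun k => ∫⁻ t, (E k).indicator 1 t ∂unitMeasure) atTop
        (𝓝 (∫⁻ _, 0 ∂unitMeasure)) := by
      refine tendsto_lintegral_of_dominated_convergence' (fun _ => 1)
        (fun k => aemeasurable_one.indicator₀ (hEm k))
        (fun k => .of_forall fun t => indicator_le_self' (fun _ _ => zero_le) t) (by simp) ?_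
      filter_upwards [hlim] with t ht
      refine tendsto_const_nhds.congr' ?_
      filter_upwards [ht.eventually (gt_mem_nhds one_pos)] with k hk
      by_cases htk : t ∈ E k
      · simp [htk] at hk
      · simp [htk]
    simpa only [lintegral_indicator_one₀ (hEm _), lintegral_zero] using h1
  rw [ENNReal.tendsto_nhds_zero]
  intro ε hε
  obtain ⟨η, hη0, hη⟩ := ENNReal.lt_iff_exists_nnreal_btwn.1 hε
  have hη0' : 0 < η := by exact_mod_cast hη0
  obtain ⟨a, ha, haS⟩ := h η hη0'
  filter_upwards [ENNReal.tendsto_nhds_zero.1 hE0 (ENNReal.ofReal a) (by simpa using ha.1)]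
    with k hk
  refine iSup₂_le fun f hf => ?_
  have hfE : MemM ((E k).indicator f) := AEMeasurable.indicator₀ hf.1 (hEm k)
  rw [hY.eq_posNorm_abs hfE, abs_indicator]
  refine (hY.posNorm.indicator_le_of_rangeENN hw hη0'.ne' haS (hEm k) hk ⟨hf.1.abs, ?_⟩).trans hη.le
  rw [← rangeNorm_eq J j hX]
  exact hf.2

/-- Constants have finite norm, so L^∞ is always contained in Y; hence Y ≠ L^∞ means that Y contains
an unbounded function. -/
lemma tendsto_fundamental_of_not_sameSpace (hY : IsRINorm Y) (h : ¬ SameSpace Y normLInfty) :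
    Tendsto (fundamental (posNorm Y)) (𝓝[>] 0) (𝓝 0) := by
  contrapose! h
  intro f hf
  rw [hY.eq_posNorm_abs hf]
  refine ⟨fun hfY => lt_top_iff_ne_top.2 fun htop => h ?_, fun hfin => ?_⟩
  · exact hY.posNorm.tendsto_fundamental hf.abs hfY htop
  · refine (hY.posNorm.mono _ _ hf.abs aemeasurable_const ?_).trans_lt
      (hY.posNorm.const_lt_top (normLInfty f).toNNReal)
    filter_upwards [ae_le_essSup (f := fun t => (f t).abs) (μ := unitMeasure)] with t ht
    rwa [ENNReal.coe_toNNReal hfin.ne]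

end Conditions

end RISpace

theorem theorem4p2
    (J : ℝ → ℝ) (hJm : AEMeasurable J (volume.restrict (Set.Ioc (0 : ℝ) 1)))
    (hJpos : ∀ t ∈ Set.Ioc (0 : ℝ) 1, 0 < J t)
    (hJinf : ∃ c : ℝ, 0 < c ∧ ∀ t ∈ Set.Ioc (0 : ℝ) 1, c ≤ J t / t)
    (j : ℕ) (hj : 1 ≤ j)
    (X Y : (ℝ → EReal) → ℝ≥0∞) (hX : RISpace.IsRINorm X) (hY : RISpace.IsRINorm Y)
    (hor : ¬ RISpace.SameSpace Y RISpace.normLInfty ∨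
      ∫⁻ r in Set.Ioo (0 : ℝ) 1, (ENNReal.ofReal (J r))⁻¹ = ∞) :
    List.TFAE [
      RISpace.IsCompactBetween (RISpace.opHPow J j) X Y,
      Tendsto (fun a : ℝ => ⨆ f ∈ RISpace.unitBall X,
          Y ((Set.Ioo 0 a).indicator (RISpace.opHPow J j f))) (𝓝[>] (0 : ℝ)) (𝓝 0),
      RISpace.AlmostCompactEmbedding (RISpace.rangeNorm J j X) Y] := by
  have hw := RISpace.isWeight_inv hJm hJinf
  rw [RISpace.tendsto_iff_smallTails hj hX hY]
  tfae_have 1 → 2 := RISpace.IsCompactBetween.smallTails hw hj hX hY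
    (hor.imp_left (RISpace.tendsto_fundamental_of_not_sameSpace hY))
  tfae_have 2 → 1 := RISpace.SmallTails.isCompactBetween hw hj hX hY
  tfae_have 2 → 3 := RISpace.SmallTails.almostCompactEmbedding hw hX hY
  tfae_have 3 → 2 := RISpace.AlmostCompactEmbedding.smallTails hw hj hX
  tfae_finish
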